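/- An \emph{Orlicz function} is a convex function $N:[0,\infty)\to[0,\infty)$ with $N(0)=0$ and $N(t)>0$ for $t>0$. A \emph{possibly degenerate Orlicz function} is a convex function $N:[0,\infty)\to[0,\infty)$ with $N(0)=0$ that is not identically zero (it may vanish near $0$). For such $N$ and $x\in\mathbb R^n$ let $$\|x\|_N=\inf\Big\{\rho>0 : \sum_{i=1}^n N\big(|x_i|/\rho\big)\le 1\Big\},\qquad N^*(s)=\sup_{t\ge 0}\,(st-N(t))\in[0,\infty],\qquad N^{*-1}(u)=\sup\{s\ge 0: N^*(s)\le u\}\quad(s,u\ge 0).$$ For $1<r<\infty$ let $r^*=r/(r-1)$ and $C_r=r^{1/r}(r^*)^{1/r^*}$. Below, $\pi$ runs over all permutations of $\{1,\dots,n\}$. (i) There is an absolute constant $c>0$ such that for all $1<r<\infty$, all $n\in\mathbb N$ and all $a_1\ge\dots\ge a_n>0$ there exists an Orlicz function $N$ such that for all $\ell=1,\dots,n$ $$N^{*-1}\Big(\frac{\ell}{n}\Big)\le C_r\Big(\frac1n\sum_{i=1}^{\ell}a_i+\Big(\frac{\ell}{n}\Big)^{1/r^*}\Big(\frac1n\sum_{i=\ell+1}^{n}|a_i|^r\Big)^{1/r}\Big)\le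 8\,N^{*-1}\Big(\frac{\ell}{n}\Big)\qquad(1)$$ and $$N^{*-1}\Big(\frac{\ell}{n^2}\Big)\le C_r\,\frac1n\Big(\frac{\ell}{n}\Big)^{1/r^*}\Big(\sum_{i=1}^{\ell}|a_i|^r\Big)^{1/r}\le 2\,N^{*-1}\Big(\frac{\ell}{n^2}\Big),$$ and such that for all $x\in\mathbb R^n$ $$c\,\|x\|_N\le\frac1{n!}\sum_{\pi}\Big(\sum_{i=1}^n|x_ia_{\pi(i)}|^r\Big)^{1/r}\le 2\,\|x\|_N .$$ (ii) For every $1<r<\infty$ there are $n_0\in\mathbb N$ and constants $a_r,b_r>0$, depending only on $r$, such that for all $n\ge n_0$, all $a_1\ge\dots\ge a_n>0$ and every possibly degenerate Orlicz function $\bar N$ for which (1) holds with $\bar N$ in place of $N$ for all $\ell=1,\dots,n$, and for which $\bar N^{*-1}$ is affine on each interval $[\frac{\ell}{n},\frac{\ell+1}{n}]$, $\ell=0,\dots,n-1$, we have for all $x\in\mathbb R^n$ $$a_r\,\|x\|_{\bar N}\le\frac1{n!}\sum_{\pi}\Big(\sum_{i=1}^n|x_ia_{\pi(i)}|^r\Big)^{1/r}\le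 b_r\,\|x\|_{\bar N}.$$ -/

import Mathlib

open scoped Nat

noncomputable section

/-- An Orlicz function `N : [0,∞) → [0,∞)`: convex, `N 0 = 0`, and `N t > 0` for `t > 0`.
Only the values of `N` on `[0,∞)` matter, here and in all definitions below. -/
structure IsOrlicz (N : ℝ → ℝ) : Prop where
  convexOn : ConvexOn ℝ (Set.Ici 0) N
  map_zero : N 0 = 0
  pos : ∀ t, 0 < t → 0 < N t

/-- An Orlicz function that may be degenerate, i.e. may vanish on an interval `[0,t₀]`:
convex, nonnegative, `N 0 = 0`, not identically zero on `[0,∞)`. -/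
structure IsDegenerateOrlicz (N : ℝ → ℝ) : Prop where
  convexOn : ConvexOn ℝ (Set.Ici 0) N
  map_zero : N 0 = 0
  nonneg : ∀ t, 0 ≤ t → 0 ≤ N t
  nontrivial : ∃ t, 0 ≤ t ∧ 0 < N t

theorem IsOrlicz.isDegenerateOrlicz {N : ℝ → ℝ} (h : IsOrlicz N) : IsDegenerateOrlicz N where
  convexOn := h.convexOn
  map_zero := h.map_zero
  nonneg t ht := by
    rcases ht.eq_or_lt with rfl | ht
    · exact h.map_zero.ge
    · exact (h.pos t ht).le
  nontrivial := ⟨1, zero_le_one, h.pos 1 one_pos⟩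

/-- The Luxemburg norm `‖x‖_N = inf {ρ > 0 | ∑ i, N (|x i| / ρ) ≤ 1}` on `ℝⁿ`. -/
def orliczNorm (N : ℝ → ℝ) {n : ℕ} (x : Fin n → ℝ) : ℝ :=
  sInf {ρ : ℝ | 0 < ρ ∧ ∑ i, N (|x i| / ρ) ≤ 1}

/-- The dual function (Legendre transform) `N*(s) = sup_{t ≥ 0} (s t - N t)`,
with value `+∞` where the supremum is infinite. -/
def orliczDual (N : ℝ → ℝ) (s : ℝ) : EReal :=
  ⨆ t : Set.Ici (0 : ℝ), ((s * (t : ℝ) - N (t : ℝ) : ℝ) : EReal)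

/-- The inverse `N*⁻¹(u) = sup {s ≥ 0 | N*(s) ≤ u}` of the dual function, for `u ≥ 0`. -/
def orliczDualInv (N : ℝ → ℝ) (u : ℝ) : ℝ :=
  sSup {s : ℝ | 0 ≤ s ∧ orliczDual N s ≤ (u : EReal)}

/-- The supremum in `orliczDualInv` is over a nonempty bounded set. -/
theorem orliczDualInv_set {N : ℝ → ℝ} (h : IsDegenerateOrlicz N) {u : ℝ} (hu : 0 ≤ u) :
    {s : ℝ | 0 ≤ s ∧ orliczDual N s ≤ (u : EReal)}.Nonempty ∧
      BddAbove {s : ℝ | 0 ≤ s ∧ orliczDual N s ≤ (u : EReal)} := by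
  refine ⟨⟨0, le_rfl, iSup_le fun t => ?_⟩, ⟨u + N 1, fun s hs => ?_⟩⟩
  · have := h.nonneg t t.2
    exact_mod_cast (by linarith : (0 : ℝ) * (t : ℝ) - N t ≤ u)
  · have h1 : ((s * 1 - N 1 : ℝ) : EReal) ≤ (u : EReal) :=
      (le_iSup (fun t : Set.Ici (0 : ℝ) => ((s * (t : ℝ) - N (t : ℝ) : ℝ) : EReal))
        ⟨1, Set.mem_Ici.2 zero_le_one⟩).trans hs.2
    have h2 : s * 1 - N 1 ≤ u := by exact_mod_cast h1
    linarith

/-- The constant `C_r = r^{1/r} (r*)^{1/r*}`, where `r* = r / (r - 1)`. -/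
def lrConst (r : ℝ) : ℝ :=
  r ^ (1 / r) * r.conjExponent ^ (1 / r.conjExponent)

/-- `C_r ((1/n) ∑_{i ≤ ℓ} a_i + (ℓ/n)^{1/r*} ((1/n) ∑_{i > ℓ} |a_i|^r)^{1/r})`.
The entry `a_i`, `1 ≤ i ≤ n`, is the value of `a` at the index `i - 1`. -/
def lrBound (r : ℝ) {n : ℕ} (a : Fin n → ℝ) (l : ℕ) : ℝ :=
  lrConst r * ((1 / (n : ℝ)) * (∑ i : Fin n with i.val < l, a i)
    + ((l : ℝ) / n) ^ (1 / r.conjExponent)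
      * ((1 / (n : ℝ)) * (∑ i : Fin n with l ≤ i.val, |a i| ^ r)) ^ (1 / r))

/-- `C_r (1/n) (ℓ/n)^{1/r*} (∑_{i ≤ ℓ} |a_i|^r)^{1/r}`. -/
def lrFineBound (r : ℝ) {n : ℕ} (a : Fin n → ℝ) (l : ℕ) : ℝ :=
  lrConst r * (1 / (n : ℝ)) * ((l : ℝ) / n) ^ (1 / r.conjExponent)
    * (∑ i : Fin n with i.val < l, |a i| ^ r) ^ (1 / r)

/-- The average `(1/n!) ∑_π (∑ i, |x_i a_{π(i)}|^r)^{1/r}` over all permutations `π`. -/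
def permAverage (r : ℝ) {n : ℕ} (a x : Fin n → ℝ) : ℝ :=
  (1 / (n ! : ℝ)) * ∑ π : Equiv.Perm (Fin n), (∑ i, |x i * a (π i)| ^ r) ^ (1 / r)

/-- `f` is affine on each interval `[ℓ/n, (ℓ+1)/n]`, `ℓ = 0, …, n - 1`. -/
def AffineOnGrid (n : ℕ) (f : ℝ → ℝ) : Prop :=
  ∀ l : ℕ, l < n → ∃ m b : ℝ,
    ∀ t ∈ Set.Icc ((l : ℝ) / n) (((l : ℝ) + 1) / n), f t = m * t + b

end

noncomputable section

/-! ### The Legendre transform of `s ↦ s ^ q` on `[0,1]` -/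

/-! Write q = r* and C = C_r. Hölder duality produces weights 0 ≤ w_i ≤ 1 with ∑ w_i^q ≤ 1 at which
∑ y_i w_i equals (∑ y_i^r)^{1/r}; hence this norm is at most 1 + ∑ `dualKernel q (y i)`. The right
side is additive in the entries, so averaging over permutations bounds the mean norm by 1 + ∑
`avgKernel q a (x i)`. The converse, `sum_avgKernel_le_one`, is a second-moment argument: the
optimizers of the kernels serve as Hölder weights whose random total mass is controlled through pair
correlations. By homogeneity, the mean norm is therefore equivalent to the Luxemburg norm of
`avgKernel q a`, and it remains to compare N with that function.

The comparison is made on the dual side. The maximum of C (1/n) ∑ a_j s_j over 0 ≤ s_j ≤ 1, ∑ s_j^q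
≤ ℓ, lies between `lrBound r a l` / 2 and `lrBound r a l`: the head of a is limited by s_j ≤ 1, the
tail by Hölder (`lrConst_mul_mean_le_lrBound`, `exists_lrBound_le`). Supporting lines turn the grid
bounds into bounds between N and `avgKernel`, up to dilation, an error 1/n per coordinate and a
linear term. Over n coordinates the errors add up to 1, and the linear term is dominated by the mean
norm. This proves (ii).

For (i), the function M = `lrConvex` is squeezed between C-dilated `avgKernel` minus 1/(rn) and
C-dilated `avgKernel`, and contains the affine functions t F_ℓ - ℓ/n², with F_ℓ = `lrFineBound r a
l`, that force the fine bounds. By `exists_tangent_lrFineBound` each of them is the maximum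
somewhere, so the fine upper bound holds without loss. As M may vanish near 0, N(t) = M(σt) + δt is
used; the factor σ < 1 pays for δ, and the strict inequality in `exists_lt_one_permAverage_le` pays
for σ. -/

/-- `sup {s y - s ^ q | 0 ≤ s ≤ 1}`: a power of `y` for small `y`, affine for large `y`. -/
def dualKernel (q y : ℝ) : ℝ :=
  sSup ((fun s : ℝ => s * y - s ^ q) '' Set.Icc 0 1)

/-- The average `(1/n) ∑ j, dualKernel q (a j * t)`. -/
def avgKernel (q : ℝ) {n : ℕ} (a : Fin n → ℝ) (t : ℝ) : ℝ :=
  (1 / (n : ℝ)) * ∑ j, dualKernel q (a j * t)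

theorem dualKernel_attained {q : ℝ} (hq : 0 < q) (y : ℝ) :
    ∃ s, 0 ≤ s ∧ s ≤ 1 ∧ dualKernel q y = s * y - s ^ q ∧
      ∀ s', 0 ≤ s' → s' ≤ 1 → s' * y - s' ^ q ≤ dualKernel q y := by
  have hc : ContinuousOn (fun s : ℝ => s * y - s ^ q) (Set.Icc 0 1) :=
    ((continuous_id.mul continuous_const).sub (Real.continuous_rpow_const hq.le)).continuousOn
  obtain ⟨s, hs, h1, h2⟩ := isCompact_Icc.exists_sSup_image_eq_and_ge
    (Set.nonempty_Icc.2 zero_le_one) hc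
  refine ⟨s, hs.1, hs.2, h1, fun s' h0 h1' => ?_⟩
  unfold dualKernel
  rw [h1]
  exact h2 s' ⟨h0, h1'⟩

theorem le_dualKernel {q : ℝ} (hq : 0 < q) (y : ℝ) {s : ℝ} (h0 : 0 ≤ s) (h1 : s ≤ 1) :
    s * y - s ^ q ≤ dualKernel q y := by
  obtain ⟨_, _, _, _, h⟩ := dualKernel_attained hq y
  exact h s h0 h1

theorem dualKernel_nonneg {q : ℝ} (hq : 0 < q) (y : ℝ) : 0 ≤ dualKernel q y := by
  have := le_dualKernel hq y le_rfl zero_le_one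
  simpa [Real.zero_rpow hq.ne'] using this

theorem dualKernel_le_self {q : ℝ} (hq : 0 < q) {y : ℝ} (hy : 0 ≤ y) : dualKernel q y ≤ y := by
  obtain ⟨s, h0, h1, h, -⟩ := dualKernel_attained hq y
  rw [h]
  have := Real.rpow_nonneg h0 q
  nlinarith

theorem dualKernel_zero {q : ℝ} (hq : 0 < q) : dualKernel q 0 = 0 :=
  le_antisymm (dualKernel_le_self hq le_rfl) (dualKernel_nonneg hq 0)

theorem dualKernel_le_half {q : ℝ} (hq : 0 < q) (y : ℝ) :
    dualKernel q y ≤ dualKernel q (2 * y) / 2 := by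
  obtain ⟨s, h0, h1, h, -⟩ := dualKernel_attained hq y
  have := Real.rpow_nonneg h0 q
  have := le_dualKernel hq (2 * y) h0 h1
  rw [h]
  linarith

theorem convexOn_dualKernel {q : ℝ} (hq : 0 < q) : ConvexOn ℝ Set.univ (dualKernel q) := by
  refine ⟨convex_univ, fun x _ y _ α β hα hβ hαβ => ?_⟩
  obtain ⟨s, h0, h1, h, -⟩ := dualKernel_attained hq (α • x + β • y)
  rw [h]
  have hx := mul_le_mul_of_nonneg_left (le_dualKernel hq x h0 h1) hα
  have hy := mul_le_mul_of_nonneg_left (le_dualKernel hq y h0 h1) hβ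
  obtain rfl : β = 1 - α := by linarith
  simp only [smul_eq_mul] at hx hy ⊢
  linarith

theorem lrConst_eq {r q : ℝ} (hr : r.HolderConjugate q) :
    lrConst r = r ^ (1 / r) * q ^ (1 / q) := by
  rw [lrConst, hr.conjExponent_eq]

theorem lrConst_pos {r q : ℝ} (hr : r.HolderConjugate q) : 0 < lrConst r := by
  rw [lrConst_eq hr]
  have := hr.pos
  have := hr.symm.pos
  positivity

/-- Young's inequality for r^{1/r} y and q^{1/q} s: the two factors cancel the denominators r and q,
and their product is C_r. -/
theorem lrConst_mul_le {r q : ℝ} (hr : r.HolderConjugate q) {s y : ℝ} (hs : 0 ≤ s) (hy : 0 ≤ y) :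
    lrConst r * (s * y) ≤ y ^ r + s ^ q := by
  have hr0 := hr.pos
  have hq0 := hr.symm.pos
  have h := Real.young_inequality_of_nonneg (a := r ^ (1 / r) * y) (b := q ^ (1 / q) * s)
    (by positivity) (by positivity) hr
  rw [Real.mul_rpow (by positivity) hy, Real.mul_rpow (by positivity) hs, ← Real.rpow_mul hr0.le,
    ← Real.rpow_mul hq0.le, one_div_mul_cancel hr0.ne', one_div_mul_cancel hq0.ne',
    Real.rpow_one, Real.rpow_one, mul_div_cancel_left₀ _ hr0.ne',
    mul_div_cancel_left₀ _ hq0.ne'] at h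
  rw [lrConst_eq hr]
  linarith

theorem lrConst_le_two {r q : ℝ} (hr : r.HolderConjugate q) : lrConst r ≤ 2 := by
  have h := lrConst_mul_le hr zero_le_one zero_le_one
  simp only [Real.one_rpow] at h
  linarith

theorem dualKernel_lrConst_le {r q : ℝ} (hr : r.HolderConjugate q) {y : ℝ} (hy : 0 ≤ y) :
    dualKernel q (lrConst r * y) ≤ y ^ r := by
  obtain ⟨s, h0, h1, h, -⟩ := dualKernel_attained hr.symm.pos (lrConst r * y)
  rw [h]
  have := lrConst_mul_le hr h0 hy
  linarith

theorem avgKernel_nonneg {q : ℝ} (hq : 0 < q) {n : ℕ} (a : Fin n → ℝ) (t : ℝ) :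
    0 ≤ avgKernel q a t :=
  mul_nonneg (by positivity) (Finset.sum_nonneg fun _ _ => dualKernel_nonneg hq _)

theorem avgKernel_le_half {q : ℝ} (hq : 0 < q) {n : ℕ} (a : Fin n → ℝ) (t : ℝ) :
    avgKernel q a t ≤ avgKernel q a (2 * t) / 2 := by
  unfold avgKernel
  rw [mul_div_assoc, Finset.sum_div]
  refine mul_le_mul_of_nonneg_left (Finset.sum_le_sum fun j _ => ?_) (by positivity)
  rw [mul_left_comm]
  exact dualKernel_le_half hq _

theorem le_avgKernel {q : ℝ} (hq : 0 < q) {n : ℕ} (a : Fin n → ℝ) (t : ℝ) {s : Fin n → ℝ}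
    (h0 : ∀ j, 0 ≤ s j) (h1 : ∀ j, s j ≤ 1) :
    t * ((1 / (n : ℝ)) * ∑ j, a j * s j) - (1 / (n : ℝ)) * ∑ j, s j ^ q ≤ avgKernel q a t := by
  unfold avgKernel
  have : t * ((1 / (n : ℝ)) * ∑ j, a j * s j) - (1 / (n : ℝ)) * ∑ j, s j ^ q
      = (1 / (n : ℝ)) * ∑ j, (s j * (a j * t) - s j ^ q) := by
    rw [Finset.sum_sub_distrib, mul_sub, mul_left_comm t, Finset.mul_sum (a := t)]
    simp only [mul_comm, mul_left_comm]
  rw [this]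
  exact mul_le_mul_of_nonneg_left
    (Finset.sum_le_sum fun j _ => le_dualKernel hq _ (h0 j) (h1 j)) (by positivity)

/-! ### Extremal vectors in Hölder's inequality -/

/-- The extremal weights are w_i^q = b_i^r / ∑ b_k^r. The bound w_i ≤ 1 is what makes them
admissible in `dualKernel`. -/
theorem exists_holder_weights {r q : ℝ} (hr : r.HolderConjugate q) {ι : Type*} (S : Finset ι)
    {b : ι → ℝ} (hb : ∀ i ∈ S, 0 ≤ b i) :
    ∃ w : ι → ℝ, (∀ i, 0 ≤ w i) ∧ (∀ i ∈ S, w i ≤ 1) ∧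
      (∀ i ∈ S, w i ^ q * ∑ k ∈ S, b k ^ r = b i ^ r) ∧
      ∑ i ∈ S, w i ^ q ≤ 1 ∧ ∑ i ∈ S, b i * w i = (∑ i ∈ S, b i ^ r) ^ (1 / r) := by
  have hr0 := hr.pos
  have hq0 := hr.symm.pos
  set R := ∑ k ∈ S, b k ^ r with hR
  have hbr : ∀ i ∈ S, 0 ≤ b i ^ r := fun i hi => Real.rpow_nonneg (hb i hi) r
  have hR0 : 0 ≤ R := Finset.sum_nonneg hbr
  rcases hR0.eq_or_lt with h | h
  · have hz := (Finset.sum_eq_zero_iff_of_nonneg hbr).1 h.symm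
    refine ⟨fun _ => 0, by simp, by simp, fun i hi => ?_, ?_, ?_⟩
    · rw [hz i hi, ← h, mul_zero]
    · simp [Real.zero_rpow hq0.ne']
    · rw [← h, Real.zero_rpow (by positivity)]
      simp
  · have hle : ∀ i ∈ S, b i ^ r ≤ R := fun i hi => Finset.single_le_sum hbr hi
    have hw : ∀ i ∈ S, ((b i ^ r / R) ^ (1 / q)) ^ q = b i ^ r / R := fun i hi => by
      rw [← Real.rpow_mul (div_nonneg (hbr i hi) hR0), one_div_mul_cancel hq0.ne', Real.rpow_one]
    -- The truncation at 0 only matters outside `S`, where `b` may be negative.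
    refine ⟨fun i => (max 0 (b i ^ r / R)) ^ (1 / q), fun i => by positivity, ?_, ?_, ?_, ?_⟩
    · intro i hi
      simp only [max_eq_right (div_nonneg (hbr i hi) hR0)]
      exact Real.rpow_le_one (div_nonneg (hbr i hi) hR0) ((div_le_one h).2 (hle i hi))
        (by positivity)
    · intro i hi
      simp only [max_eq_right (div_nonneg (hbr i hi) hR0)]
      rw [hw i hi, div_mul_cancel₀ _ h.ne']
    · have key : ∀ i ∈ S, ((max 0 (b i ^ r / R)) ^ (1 / q)) ^ q = b i ^ r / R := fun i hi => by
        rw [max_eq_right (div_nonneg (hbr i hi) hR0), hw i hi]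
      rw [Finset.sum_congr rfl key, ← Finset.sum_div, div_self h.ne']
    · have key : ∀ i ∈ S, b i * (max 0 (b i ^ r / R)) ^ (1 / q) = b i ^ r * (R ^ (1 / q))⁻¹ := by
        intro i hi
        rw [max_eq_right (div_nonneg (hbr i hi) hR0), Real.div_rpow (hbr i hi) hR0,
          ← Real.rpow_mul (hb i hi), mul_one_div r q, hr.div_conj_eq_sub_one, ← mul_div_assoc,
          div_eq_mul_inv]
        congr 1
        rcases (hb i hi).eq_or_lt with h0 | h0
        · rw [← h0, zero_mul, Real.zero_rpow hr0.ne']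
        · nth_rw 1 [← Real.rpow_one (b i)]
          rw [← Real.rpow_add h0]
          congr 1
          ring
      rw [Finset.sum_congr rfl key, ← Finset.sum_mul, ← hR, ← Real.rpow_neg hR0]
      nth_rw 1 [← Real.rpow_one R]
      rw [← Real.rpow_add h]
      congr 1
      have := hr.inv_add_inv_eq_one
      simp only [one_div]
      linarith

theorem rpow_sum_le_one_add {r q : ℝ} (hr : r.HolderConjugate q) {n : ℕ} {y : Fin n → ℝ}
    (hy : ∀ i, 0 ≤ y i) :
    (∑ i, y i ^ r) ^ (1 / r) ≤ 1 + ∑ i, dualKernel q (y i) := by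
  obtain ⟨w, h0, h1, -, h2, h3⟩ := exists_holder_weights hr Finset.univ (fun i _ => hy i)
  rw [← h3]
  have : ∑ i, (w i * y i - w i ^ q) ≤ ∑ i, dualKernel q (y i) :=
    Finset.sum_le_sum fun i hi => le_dualKernel hr.symm.pos _ (h0 i) (h1 i hi)
  rw [Finset.sum_sub_distrib] at this
  simp only [mul_comm (y _)]
  linarith

/-- The kernel is tested at s = (r/C) w rather than at w. This is admissible because r ≤ q gives r ≤
C, and (r/C)^q = r/q, so the sum of the tested values is r ∑ y w - (r/q) ∑ w^q; division by r gives
the claim. -/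
theorem rpow_sum_le_of_le_two {r q : ℝ} (hr : r.HolderConjugate q) (hr2 : r ≤ 2) {n : ℕ}
    {y : Fin n → ℝ} (hy : ∀ i, 0 ≤ y i) :
    (∑ i, y i ^ r) ^ (1 / r) ≤ 1 / q + 1 / r * ∑ i, dualKernel q (lrConst r * y i) := by
  have hr0 := hr.pos
  have hq0 := hr.symm.pos
  have hC := lrConst_pos hr
  have hrq : r ≤ q := by
    have := hr.mul_eq_add
    nlinarith [hr.lt]
  have hrC : r ≤ lrConst r := by
    rw [lrConst_eq hr]
    calc r = r ^ (1 / r) * r ^ (1 / q) := by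
          rw [← Real.rpow_add hr0, one_div, one_div, hr.inv_add_inv_eq_one, Real.rpow_one]
      _ ≤ _ := by gcongr
  have hCq : (r / lrConst r) ^ q = r / q := by
    rw [Real.div_rpow hr0.le hC.le, lrConst_eq hr, Real.mul_rpow (by positivity) (by positivity),
      ← Real.rpow_mul hr0.le, ← Real.rpow_mul hq0.le, one_div_mul_cancel hq0.ne', Real.rpow_one,
      ← div_div, ← Real.rpow_sub hr0]
    have : q - 1 / r * q = 1 := by
      have := hr.mul_eq_add
      field_simp
      linarith
    rw [this, Real.rpow_one]
  obtain ⟨w, h0, h1, -, h2, h3⟩ := exists_holder_weights hr Finset.univ (fun i _ => hy i)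
  rw [← h3]
  have : ∑ i, (r * (y i * w i) - r / q * w i ^ q) ≤ ∑ i, dualKernel q (lrConst r * y i) := by
    refine Finset.sum_le_sum fun i hi => ?_
    have h := le_dualKernel hq0 (lrConst r * y i) (s := r / lrConst r * w i)
      (mul_nonneg (by positivity) (h0 i))
      (mul_le_one₀ ((div_le_one hC).2 hrC) (h0 i) (h1 i hi))
    rw [Real.mul_rpow (by positivity) (h0 i), hCq] at h
    refine le_trans (le_of_eq ?_) h
    field_simp
  rw [Finset.sum_sub_distrib, ← Finset.mul_sum, ← Finset.mul_sum] at this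
  have h4 := mul_le_mul_of_nonneg_left this (by positivity : 0 ≤ 1 / r)
  have h5 : 1 / r * (r * ∑ i, y i * w i - r / q * ∑ i, w i ^ q)
      = ∑ i, y i * w i - 1 / q * ∑ i, w i ^ q := by
    field_simp
  have h6 := mul_le_mul_of_nonneg_left h2 (by positivity : 0 ≤ 1 / q)
  linarith

/-! ### Averages over permutations -/

theorem sum_perm_apply {n : ℕ} (f : Fin n → ℝ) (i : Fin n) :
    (n : ℝ) * ∑ π : Equiv.Perm (Fin n), f (π i) = (n ! : ℝ) * ∑ j, f j := by
  have h : ∀ k : Fin n, ∑ π : Equiv.Perm (Fin n), f (π k) = ∑ π : Equiv.Perm (Fin n), f (π i) :=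
    fun k => Fintype.sum_equiv (Equiv.mulRight (Equiv.swap i k)) _ _ fun π => by simp
  have h1 : ∑ k : Fin n, ∑ π : Equiv.Perm (Fin n), f (π k)
      = (n : ℝ) * ∑ π : Equiv.Perm (Fin n), f (π i) := by
    simp [h]
  rw [← h1, Finset.sum_comm]
  simp [Equiv.sum_comp, Fintype.card_perm]

/-- For i ≠ k the pair (π i, π k) is uniform on the n(n-1) off-diagonal pairs, and n/(n-1) ≤ 2. -/
theorem sum_perm_apply_apply_le {n : ℕ} {G : Fin n → Fin n → ℝ} (hG : ∀ j l, 0 ≤ G j l)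
    {i k : Fin n} (hik : i ≠ k) :
    (n : ℝ) ^ 2 * ∑ π : Equiv.Perm (Fin n), G (π i) (π k) ≤ 2 * (n ! : ℝ) * ∑ j, ∑ l, G j l := by
  have hn : 2 ≤ n := by
    have h1 := i.2
    have h2 := k.2
    have h3 : i.val ≠ k.val := fun h => hik (Fin.ext h)
    omega
  have h : ∀ m ∈ Finset.univ.erase i, ∑ π : Equiv.Perm (Fin n), G (π i) (π m)
      = ∑ π : Equiv.Perm (Fin n), G (π i) (π k) := fun m hm =>
    Fintype.sum_equiv (Equiv.mulRight (Equiv.swap k m)) _ _ fun π => by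
      have hm' : i ≠ m := (Finset.ne_of_mem_erase hm).symm
      simp [Equiv.swap_apply_of_ne_of_ne hik hm']
  have h1 : ∑ m ∈ Finset.univ.erase i, ∑ π : Equiv.Perm (Fin n), G (π i) (π m)
      = ((n : ℝ) - 1) * ∑ π : Equiv.Perm (Fin n), G (π i) (π k) := by
    rw [Finset.sum_congr rfl h, Finset.sum_const, Finset.card_erase_of_mem (Finset.mem_univ _),
      Finset.card_univ, Fintype.card_fin, nsmul_eq_mul, Nat.cast_sub (by omega), Nat.cast_one]
  have h2 : ∑ m ∈ Finset.univ.erase i, ∑ π : Equiv.Perm (Fin n), G (π i) (π m)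
      ≤ ∑ π : Equiv.Perm (Fin n), ∑ l, G (π i) l := by
    rw [Finset.sum_comm]
    refine Finset.sum_le_sum fun π _ => ?_
    rw [← Equiv.sum_comp π (fun l => G (π i) l)]
    exact Finset.sum_le_sum_of_subset_of_nonneg (Finset.erase_subset _ _) fun _ _ _ => hG _ _
  have h3 := sum_perm_apply (fun j => ∑ l, G j l) i
  have hn' : (2 : ℝ) ≤ n := by exact_mod_cast hn
  have hT : 0 ≤ ∑ π : Equiv.Perm (Fin n), G (π i) (π k) := Finset.sum_nonneg fun _ _ => hG _ _
  rw [h1] at h2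
  have h4 := mul_le_mul_of_nonneg_left h2 (by linarith : (0 : ℝ) ≤ n)
  rw [h3] at h4
  nlinarith [mul_nonneg (by nlinarith : (0 : ℝ) ≤ n * (n - 2)) hT]

theorem sum_perm_sum_apply {n : ℕ} (P : Fin n → Fin n → ℝ) :
    (n : ℝ) * ∑ π : Equiv.Perm (Fin n), ∑ i, P i (π i) = (n ! : ℝ) * ∑ i, ∑ j, P i j := by
  rw [Finset.sum_comm, Finset.mul_sum, Finset.mul_sum]
  exact Finset.sum_congr rfl fun i _ => sum_perm_apply (P i) i

/-- The diagonal terms i = k are bounded through Q ≤ 1, the off-diagonal ones through pair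
correlations. -/
theorem sum_perm_sum_mul_sum_le {n : ℕ} {P Q : Fin n → Fin n → ℝ} (hP : ∀ i j, 0 ≤ P i j)
    (hQ : ∀ i j, 0 ≤ Q i j) (hQ1 : ∀ i j, Q i j ≤ 1) :
    (n : ℝ) ^ 2 * ∑ π : Equiv.Perm (Fin n), (∑ i, P i (π i)) * ∑ k, Q k (π k)
      ≤ (n ! : ℝ) * (n * (∑ i, ∑ j, P i j) + 2 * (∑ i, ∑ j, P i j) * ∑ k, ∑ l, Q k l) := by
  have hterm : ∀ i k : Fin n, (n : ℝ) ^ 2 * ∑ π : Equiv.Perm (Fin n), P i (π i) * Q k (π k)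
      ≤ (if i = k then (n ! : ℝ) * (n * ∑ j, P i j) else 0)
        + 2 * (n ! : ℝ) * ((∑ j, P i j) * ∑ l, Q k l) := by
    intro i k
    have hPQ : 0 ≤ 2 * (n ! : ℝ) * ((∑ j, P i j) * ∑ l, Q k l) :=
      mul_nonneg (by positivity) (mul_nonneg (Finset.sum_nonneg fun _ _ => hP _ _)
        (Finset.sum_nonneg fun _ _ => hQ _ _))
    split_ifs with hik
    · subst hik
      have h1 : ∑ π : Equiv.Perm (Fin n), P i (π i) * Q i (π i)
          ≤ ∑ π : Equiv.Perm (Fin n), P i (π i) :=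
        Finset.sum_le_sum fun π _ => mul_le_of_le_one_right (hP _ _) (hQ1 _ _)
      have h2 := mul_le_mul_of_nonneg_left h1 (by positivity : (0 : ℝ) ≤ (n : ℝ) ^ 2)
      rw [sq, mul_assoc (n : ℝ) n (∑ π : Equiv.Perm (Fin n), P i (π i)),
        sum_perm_apply (P i) i] at h2
      rw [sq]
      linarith
    · have h := sum_perm_apply_apply_le (G := fun j l => P i j * Q k l)
        (fun j l => mul_nonneg (hP _ _) (hQ _ _)) hik
      rw [Finset.sum_mul_sum]
      linarith
  have h := Finset.sum_le_sum fun i (_ : i ∈ Finset.univ) =>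
    Finset.sum_le_sum fun k (_ : k ∈ Finset.univ) => hterm i k
  calc (n : ℝ) ^ 2 * ∑ π : Equiv.Perm (Fin n), (∑ i, P i (π i)) * ∑ k, Q k (π k)
      = ∑ i, ∑ k, (n : ℝ) ^ 2 * ∑ π : Equiv.Perm (Fin n), P i (π i) * Q k (π k) := by
        simp_rw [Finset.sum_mul_sum]
        rw [Finset.sum_comm, Finset.mul_sum]
        refine Finset.sum_congr rfl fun i _ => ?_
        rw [Finset.sum_comm, Finset.mul_sum]
    _ ≤ _ := h
    _ = _ := by
        simp only [Finset.sum_add_distrib, Finset.sum_ite_eq, Finset.mem_univ, if_true,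
          ← Finset.mul_sum, ← Finset.sum_mul]
        ring

/-! ### The average over permutations -/

theorem permAverage_nonneg (r : ℝ) {n : ℕ} (a x : Fin n → ℝ) : 0 ≤ permAverage r a x := by
  unfold permAverage
  exact mul_nonneg (by positivity) (Finset.sum_nonneg fun _ _ => Real.rpow_nonneg
    (Finset.sum_nonneg fun _ _ => Real.rpow_nonneg (abs_nonneg _) _) _)

theorem permAverage_mul {r : ℝ} (hr : 0 < r) {n : ℕ} (a x : Fin n → ℝ) {c : ℝ} (hc : 0 ≤ c) :
    permAverage r a (fun i => c * |x i|) = c * permAverage r a x := by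
  unfold permAverage
  rw [mul_left_comm c, Finset.mul_sum (a := c)]
  congr 1
  refine Finset.sum_congr rfl fun π _ => ?_
  have : ∀ i, |c * |x i| * a (π i)| ^ r = c ^ r * |x i * a (π i)| ^ r := fun i => by
    rw [← Real.mul_rpow hc (abs_nonneg _), abs_mul, abs_mul, abs_mul, abs_abs, abs_of_nonneg hc,
      mul_assoc]
  rw [Finset.sum_congr rfl fun i _ => this i, ← Finset.mul_sum,
    Real.mul_rpow (by positivity) (Finset.sum_nonneg fun _ _ => by positivity), ← Real.rpow_mul hc,
    mul_one_div_cancel hr.ne', Real.rpow_one]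

theorem le_permAverage {r : ℝ} {n : ℕ} {a x : Fin n → ℝ} {m : ℝ} {f : Equiv.Perm (Fin n) → ℝ}
    (hf : (n ! : ℝ) * m ≤ ∑ π, f π) (h : ∀ π, f π ≤ (∑ i, |x i * a (π i)| ^ r) ^ (1 / r)) :
    m ≤ permAverage r a x := by
  have h1 := hf.trans (Finset.sum_le_sum fun π _ => h π)
  have h0 : (0 : ℝ) < n ! := by exact_mod_cast n.factorial_pos
  unfold permAverage
  rw [one_div_mul_eq_div, le_div_iff₀' h0]
  exact h1

theorem permAverage_le {r : ℝ} {n : ℕ} {a x : Fin n → ℝ} {m : ℝ} {f : Equiv.Perm (Fin n) → ℝ}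
    (hf : ∑ π, f π ≤ (n ! : ℝ) * m) (h : ∀ π, (∑ i, |x i * a (π i)| ^ r) ^ (1 / r) ≤ f π) :
    permAverage r a x ≤ m := by
  have h1 := (Finset.sum_le_sum fun π _ => h π).trans hf
  have h0 : (0 : ℝ) < n ! := by exact_mod_cast n.factorial_pos
  unfold permAverage
  rw [one_div_mul_eq_div, div_le_iff₀' h0]
  exact h1

/-- With optimizers s_ij of the kernels, ∑ `avgKernel` = Y - V, where Y and V are the means over π
of ∑ P_{i,π(i)} and W = ∑ s_{i,π(i)}^q. Hölder bounds the norm below by ∑ P_{i,π(i)} / (1 + W).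
Linearizing 1/(1 + W) leaves only first moments and one correlation, and gives a mean norm of at
least Y / (2 + 2V). -/
theorem sum_avgKernel_le_one {r q : ℝ} (hr : r.HolderConjugate q) {n : ℕ} {a x : Fin n → ℝ}
    (ha : ∀ i, 0 ≤ a i) (hx : ∀ i, 0 ≤ x i) (h : permAverage r a x < 1 / 2) :
    ∑ i, avgKernel q a (x i) ≤ 1 := by
  have hr0 := hr.pos
  have hq0 := hr.symm.pos
  rcases Nat.eq_zero_or_pos n with rfl | hn
  · simp
  have hn0 : (0 : ℝ) < n := by exact_mod_cast hn
  choose s h0 h1 hs _ using fun i j => dualKernel_attained hq0 (a j * x i)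
  set P : Fin n → Fin n → ℝ := fun i j => s i j * (a j * x i) with hPdef
  set Q : Fin n → Fin n → ℝ := fun i j => s i j ^ q with hQdef
  have hP : ∀ i j, 0 ≤ P i j := fun i j => mul_nonneg (h0 i j) (mul_nonneg (ha j) (hx i))
  have hQ : ∀ i j, 0 ≤ Q i j := fun i j => Real.rpow_nonneg (h0 i j) q
  have hQ1 : ∀ i j, Q i j ≤ 1 := fun i j => Real.rpow_le_one (h0 i j) (h1 i j) hq0.le
  set Y : ℝ := (1 / (n : ℝ)) * ∑ i, ∑ j, P i j with hY
  set V : ℝ := (1 / (n : ℝ)) * ∑ i, ∑ j, Q i j with hV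
  have hY0 : 0 ≤ Y := mul_nonneg (by positivity)
    (Finset.sum_nonneg fun _ _ => Finset.sum_nonneg fun _ _ => hP _ _)
  have hV0 : 0 ≤ V := mul_nonneg (by positivity)
    (Finset.sum_nonneg fun _ _ => Finset.sum_nonneg fun _ _ => hQ _ _)
  have hsum : ∑ i, avgKernel q a (x i) = Y - V := by
    rw [hY, hV, ← mul_sub, ← Finset.sum_sub_distrib, Finset.mul_sum]
    refine Finset.sum_congr rfl fun i _ => ?_
    rw [avgKernel, ← Finset.sum_sub_distrib]
    simp only [hs, hPdef, hQdef]
  -- This value maximizes 2/b - (2 + 2V)/b², the coefficient of Y in the averaged lower bound.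
  set b : ℝ := 2 + 2 * V with hb
  have hb0 : 0 < b := by positivity
  have hm1 : ∑ π : Equiv.Perm (Fin n), ∑ i, P i (π i) = (n ! : ℝ) * Y := by
    have := sum_perm_sum_apply P
    rw [hY]
    field_simp
    linarith
  have hm2 : ∑ π : Equiv.Perm (Fin n), (∑ i, P i (π i)) * ∑ k, Q k (π k)
      ≤ (n ! : ℝ) * (Y + 2 * Y * V) := by
    have := sum_perm_sum_mul_sum_le hP hQ hQ1
    rw [← le_div_iff₀' (by positivity)] at this
    refine this.trans (le_of_eq ?_)
    rw [hY, hV]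
    field_simp
  have hAve : Y / b ≤ permAverage r a x := by
    refine le_permAverage
      (f := fun π => (∑ i, P i (π i)) * (2 / b - (1 + ∑ k, Q k (π k)) / b ^ 2)) ?_ fun π => ?_
    · have e : ∑ π : Equiv.Perm (Fin n),
          (∑ i, P i (π i)) * (2 / b - (1 + ∑ k, Q k (π k)) / b ^ 2)
          = (2 / b - 1 / b ^ 2) * ∑ π : Equiv.Perm (Fin n), ∑ i, P i (π i)
            - 1 / b ^ 2 *
              ∑ π : Equiv.Perm (Fin n), (∑ i, P i (π i)) * ∑ k, Q k (π k) := by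
        rw [Finset.mul_sum, Finset.mul_sum, ← Finset.sum_sub_distrib]
        exact Finset.sum_congr rfl fun π _ => by ring
      rw [e, hm1]
      have h5 := mul_le_mul_of_nonneg_left hm2 (by positivity : 0 ≤ 1 / b ^ 2)
      have h6 : (n ! : ℝ) * (Y / b) = (2 / b - 1 / b ^ 2) * ((n ! : ℝ) * Y)
          - 1 / b ^ 2 * ((n ! : ℝ) * (Y + 2 * Y * V)) := by
        field_simp
        rw [hb]
        ring
      linarith
    · set W := ∑ k, Q k (π k) with hW
      have hW0 : 0 ≤ W := Finset.sum_nonneg fun _ _ => hQ _ _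
      set X := (∑ i, |x i * a (π i)| ^ r) ^ (1 / r) with hX
      have hX0 : 0 ≤ X := by positivity
      have hH : ∑ i, P i (π i) ≤ X * W ^ (1 / q) := by
        have := Real.inner_le_Lp_mul_Lq Finset.univ (fun i => x i * a (π i))
          (fun i => s i (π i)) hr
        simp only [abs_of_nonneg (h0 _ _)] at this
        refine le_trans (le_of_eq (Finset.sum_congr rfl fun i _ => ?_)) this
        simp only [hPdef]
        ring
      have hW1 : W ^ (1 / q) ≤ 1 + W := by
        calc W ^ (1 / q) ≤ (1 + W) ^ (1 / q) :=
              Real.rpow_le_rpow hW0 (by linarith) (by positivity)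
          _ ≤ (1 + W) ^ (1 : ℝ) := Real.rpow_le_rpow_of_exponent_le (by linarith)
              ((div_le_one hq0).2 hr.symm.lt.le)
          _ = 1 + W := Real.rpow_one _
      have hPW : ∑ i, P i (π i) ≤ X * (1 + W) :=
        hH.trans (mul_le_mul_of_nonneg_left hW1 hX0)
      -- The tangent line of the convex function z ↦ 1/z at z = b lies below it.
      have h7 : 2 / b - (1 + W) / b ^ 2 ≤ 1 / (1 + W) := by
        rw [div_sub_div _ _ hb0.ne' (by positivity), div_le_div_iff₀ (by positivity) (by positivity)]
        nlinarith [mul_nonneg hb0.le (sq_nonneg (b - (1 + W)))]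
      calc (∑ i, P i (π i)) * (2 / b - (1 + W) / b ^ 2)
          ≤ (∑ i, P i (π i)) * (1 / (1 + W)) :=
            mul_le_mul_of_nonneg_left h7 (Finset.sum_nonneg fun _ _ => hP _ _)
        _ ≤ X * (1 + W) * (1 / (1 + W)) := mul_le_mul_of_nonneg_right hPW (by positivity)
        _ = X := by field_simp
  have h8 : Y / b < 1 / 2 := hAve.trans_lt h
  rw [div_lt_div_iff₀ hb0 two_pos] at h8
  rw [hsum]
  linarith

/-- The extremal weights of `a` are permuted along with `a`: their q-norm is independent of π, and
each x_i meets the same average (1/n) ∑ a_j w_j. -/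
theorem mean_mul_rpow_sum_le_permAverage {r q : ℝ} (hr : r.HolderConjugate q) {n : ℕ}
    {a x : Fin n → ℝ} (ha : ∀ i, 0 ≤ a i) (hx : ∀ i, 0 ≤ x i) :
    (1 / (n : ℝ)) * (∑ i, x i) * (∑ j, a j ^ r) ^ (1 / r) ≤ permAverage r a x := by
  rcases Nat.eq_zero_or_pos n with rfl | hn
  · simp [permAverage_nonneg]
  have hn0 : (0 : ℝ) < n := by exact_mod_cast hn
  have hr0 := hr.pos
  obtain ⟨w, h0, -, -, h2, h3⟩ := exists_holder_weights hr Finset.univ (fun i _ => ha i)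
  rw [← h3]
  refine le_permAverage (f := fun π => ∑ i, x i * (a (π i) * w (π i))) (le_of_eq ?_) fun π => ?_
  · have := sum_perm_sum_apply fun i j => x i * (a j * w j)
    rw [← Finset.sum_mul_sum] at this
    refine mul_left_cancel₀ hn0.ne' (Eq.trans ?_ this.symm)
    generalize ∑ j, a j * w j = A
    field_simp
  · have := Real.inner_le_Lp_mul_Lq Finset.univ (fun i => x i * a (π i)) (fun i => w (π i)) hr
    simp only [abs_of_nonneg (h0 _)] at this
    rw [Equiv.sum_comp π (fun j => w j ^ q)] at this
    refine le_trans (le_of_eq (Finset.sum_congr rfl fun i _ => by ring))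
      (this.trans (mul_le_of_le_one_right (by positivity) (Real.rpow_le_one
        (Finset.sum_nonneg fun i _ => Real.rpow_nonneg (h0 i) q) h2
        (one_div_nonneg.2 hr.symm.nonneg))))

theorem mul_mean_le_permAverage {r : ℝ} (hr : 0 < r) {n : ℕ} {a x : Fin n → ℝ}
    (i : Fin n) :
    x i * ((1 / (n : ℝ)) * ∑ j, a j) ≤ permAverage r a x := by
  have hn0 : (0 : ℝ) < n := by exact_mod_cast i.pos
  refine le_permAverage (f := fun π => x i * a (π i)) (le_of_eq ?_) fun π => ?_
  · have := sum_perm_apply a i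
    rw [← Finset.mul_sum]
    field_simp
    linear_combination (-(x i)) * this
  · calc x i * a (π i) ≤ |x i * a (π i)| := le_abs_self _
      _ = (|x i * a (π i)| ^ r) ^ (1 / r) := by
        rw [← Real.rpow_mul (abs_nonneg _), mul_one_div_cancel hr.ne', Real.rpow_one]
      _ ≤ _ := Real.rpow_le_rpow (by positivity)
        (Finset.single_le_sum (f := fun i => |x i * a (π i)| ^ r) (fun _ _ => by positivity)
          (Finset.mem_univ i)) (by positivity)

/-- If the entries of every rearrangement satisfy `‖y‖ ≤ α + β ∑ i, dualKernel q (c * y i)`, the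
average satisfies the corresponding bound. -/
theorem permAverage_le_of_forall {r q : ℝ} {n : ℕ} {a x : Fin n → ℝ}
    (ha : ∀ i, 0 ≤ a i) (hx : ∀ i, 0 ≤ x i) {α β c : ℝ}
    (h : ∀ y : Fin n → ℝ, (∀ i, 0 ≤ y i) →
      (∑ i, y i ^ r) ^ (1 / r) ≤ α + β * ∑ i, dualKernel q (c * y i)) :
    permAverage r a x ≤ α + β * ∑ i, avgKernel q a (c * x i) := by
  rcases Nat.eq_zero_or_pos n with rfl | hn
  · simpa [permAverage] using h Fin.elim0 (fun i => i.elim0)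
  have hn0 : (0 : ℝ) < n := by exact_mod_cast hn
  refine permAverage_le
    (f := fun π => α + β * ∑ i, dualKernel q (c * (x i * a (π i)))) (le_of_eq ?_) fun π => ?_
  · rw [Finset.sum_add_distrib, ← Finset.mul_sum]
    have := sum_perm_sum_apply fun i j => dualKernel q (c * (x i * a j))
    have e : ∑ i, avgKernel q a (c * x i)
        = (1 / (n : ℝ)) * ∑ i, ∑ j, dualKernel q (c * (x i * a j)) := by
      rw [Finset.mul_sum]
      refine Finset.sum_congr rfl fun i _ => ?_
      unfold avgKernel
      congr 1
      exact Finset.sum_congr rfl fun j _ => by congr 1; ring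
    rw [e]
    simp only [Finset.sum_const, Finset.card_univ, Fintype.card_perm, Fintype.card_fin,
      nsmul_eq_mul]
    generalize ∑ i, ∑ j, dualKernel q (c * (x i * a j)) = A at this ⊢
    generalize ∑ π : Equiv.Perm (Fin n), ∑ i, dualKernel q (c * (x i * a (π i))) = B at this ⊢
    field_simp
    linear_combination β * this
  · have hy : ∀ i, 0 ≤ x i * a (π i) := fun i => mul_nonneg (hx i) (ha _)
    simp only [abs_of_nonneg (hy _)]
    exact h _ hy

/-! ### Comparison of the average with a Luxemburg norm -/

/-- Homogeneity reduces the bound to the hypothesis at x/ρ. The admissible ρ are also recorded: they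
show that the infimum defining the norm is over a nonempty set, as the converse
`permAverage_le_orliczNorm` requires. -/
theorem orliczNorm_le_permAverage {r : ℝ} (hr : 0 < r) {n : ℕ} {a : Fin n → ℝ} {N : ℝ → ℝ}
    {c : ℝ} (hc : 0 < c)
    (h : ∀ x : Fin n → ℝ, (∀ i, 0 ≤ x i) → permAverage r a x < c → ∑ i, N (x i) ≤ 1)
    (x : Fin n → ℝ) :
    (∀ ρ, permAverage r a x / c < ρ → 0 < ρ ∧ ∑ i, N (|x i| / ρ) ≤ 1) ∧
      c * orliczNorm N x ≤ permAverage r a x := by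
  have key : ∀ ρ, permAverage r a x / c < ρ → 0 < ρ ∧ ∑ i, N (|x i| / ρ) ≤ 1 := by
    intro ρ hρ
    have h0 : 0 < ρ := lt_of_le_of_lt (div_nonneg (permAverage_nonneg r a x) hc.le) hρ
    refine ⟨h0, ?_⟩
    have h1 := h (fun i => ρ⁻¹ * |x i|) (fun i => by positivity) (by
      rw [permAverage_mul hr a x (by positivity), inv_mul_lt_iff₀ h0, ← div_lt_iff₀ hc]
      exact hρ)
    simpa only [div_eq_inv_mul] using h1
  refine ⟨key, ?_⟩
  rw [← le_div_iff₀' hc]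
  refine le_of_forall_gt_imp_ge_of_dense fun ρ hρ => ?_
  exact csInf_le ⟨0, fun ρ hρ => hρ.1.le⟩ (key ρ hρ)

theorem permAverage_le_orliczNorm {r : ℝ} (hr : 0 < r) {n : ℕ} {a : Fin n → ℝ} {N : ℝ → ℝ}
    {K : ℝ} (hK : 0 < K)
    (h : ∀ x : Fin n → ℝ, (∀ i, 0 ≤ x i) → ∑ i, N (x i) ≤ 1 → permAverage r a x ≤ K)
    (x : Fin n → ℝ) {ρ₀ : ℝ} (hρ₀ : 0 < ρ₀ ∧ ∑ i, N (|x i| / ρ₀) ≤ 1) :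
    permAverage r a x ≤ K * orliczNorm N x := by
  rw [← div_le_iff₀' hK]
  refine le_csInf ⟨ρ₀, hρ₀⟩ fun ρ hρ => ?_
  have h0 := hρ.1
  have h1 := h (fun i => ρ⁻¹ * |x i|) (fun i => by positivity)
    (by simpa only [div_eq_inv_mul] using hρ.2)
  rw [permAverage_mul hr a x (by positivity), inv_mul_le_iff₀ h0] at h1
  rw [div_le_iff₀' hK]
  linarith

/-! ### The inverse of the dual function -/

theorem le_orliczDualInv {N : ℝ → ℝ} (h : IsDegenerateOrlicz N) {u s : ℝ} (hu : 0 ≤ u)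
    (hs : 0 ≤ s) (H : ∀ t, 0 ≤ t → s * t - N t ≤ u) : s ≤ orliczDualInv N u :=
  le_csSup (orliczDualInv_set h hu).2 ⟨hs, iSup_le fun t => by exact_mod_cast H t t.2⟩

theorem orliczDualInv_mul_le {N : ℝ → ℝ} (h : IsDegenerateOrlicz N) {u t : ℝ} (hu : 0 ≤ u)
    (ht : 0 ≤ t) : orliczDualInv N u * t ≤ N t + u := by
  rcases ht.eq_or_lt with rfl | ht
  · rw [mul_zero, h.map_zero, zero_add]
    exact hu
  rw [← le_div_iff₀ ht]
  refine csSup_le (orliczDualInv_set h hu).1 fun s hs => ?_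
  have h1 : ((s * t - N t : ℝ) : EReal) ≤ (u : EReal) :=
    (le_iSup (fun t : Set.Ici (0 : ℝ) => ((s * (t : ℝ) - N (t : ℝ) : ℝ) : EReal))
      ⟨t, Set.mem_Ici.2 ht.le⟩).trans hs.2
  have h2 : s * t - N t ≤ u := by exact_mod_cast h1
  rw [le_div_iff₀ ht]
  linarith

theorem orliczDualInv_nonneg {N : ℝ → ℝ} (h : IsDegenerateOrlicz N) {u : ℝ} (hu : 0 ≤ u) :
    0 ≤ orliczDualInv N u :=
  le_orliczDualInv h hu le_rfl fun t ht => by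
    have := h.nonneg t ht
    linarith

/-- The slope is the right derivative at t, the infimum of the secant slopes to the right, bounded
below by the secant slopes to the left. -/
theorem ConvexOn.exists_supporting_line {N : ℝ → ℝ} (h : ConvexOn ℝ (Set.Ici 0) N) {t : ℝ}
    (ht : 0 < t) : ∃ s, ∀ y, 0 ≤ y → N t + s * (y - t) ≤ N y := by
  set T : Set ℝ := (fun y => (N y - N t) / (y - t)) '' Set.Ioi t with hT
  have hne : T.Nonempty := ⟨_, t + 1, Set.mem_Ioi.2 (by linarith), rfl⟩
  have hlow : ∀ y, 0 ≤ y → y < t → ∀ m ∈ T, (N t - N y) / (t - y) ≤ m := by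
    rintro y hy hyt _ ⟨z, hz, rfl⟩
    exact h.slope_mono_adjacent (Set.mem_Ici.2 hy)
      (Set.mem_Ici.2 (ht.le.trans (Set.mem_Ioi.1 hz).le)) hyt hz
  refine ⟨sInf T, fun y hy => ?_⟩
  rcases lt_trichotomy y t with hyt | rfl | hyt
  · have h1 := le_csInf hne (hlow y hy hyt)
    rw [div_le_iff₀ (by linarith)] at h1
    linarith
  · simp
  · have h1 : sInf T ≤ (N y - N t) / (y - t) :=
      csInf_le ⟨_, fun m hm => hlow 0 le_rfl ht m hm⟩ ⟨y, hyt, rfl⟩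
    rw [le_div_iff₀ (by linarith)] at h1
    linarith

/-- A convex function is recovered from the inverse of its dual. -/
theorem IsDegenerateOrlicz.exists_eq_orliczDualInv {N : ℝ → ℝ} (h : IsDegenerateOrlicz N) {t : ℝ}
    (ht : 0 < t) : ∃ s u, 0 ≤ s ∧ 0 ≤ u ∧ N t = s * t - u ∧ ∀ y, 0 ≤ y → s * y - N y ≤ u := by
  obtain ⟨s, hs⟩ := h.convexOn.exists_supporting_line ht
  have h0 := hs 0 le_rfl
  rw [h.map_zero] at h0
  have h1 := h.nonneg t ht.le
  refine ⟨s, s * t - N t, ?_, by linarith, by ring, fun y hy => ?_⟩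
  · by_contra hneg
    push Not at hneg
    nlinarith
  · have := hs y hy
    linarith

/-! ### The bounds in terms of partial sums -/

theorem one_le_lrConst {r q : ℝ} (hr : r.HolderConjugate q) : 1 ≤ lrConst r := by
  rw [lrConst_eq hr]
  exact one_le_mul_of_one_le_of_one_le
    (Real.one_le_rpow hr.lt.le (one_div_nonneg.2 hr.nonneg))
    (Real.one_le_rpow hr.symm.lt.le (one_div_nonneg.2 hr.symm.nonneg))

theorem one_div_add_one_div_eq_one {r q : ℝ} (hr : r.HolderConjugate q) : 1 / r + 1 / q = 1 := by
  have := hr.inv_add_inv_eq_one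
  simpa only [one_div]

theorem rpow_mul_rpow_div {r q : ℝ} (hr : r.HolderConjugate q) {n x y : ℝ} (hn : 0 < n)
    (hx : 0 ≤ x) (hy : 0 ≤ y) :
    (x / n) ^ (1 / q) * (1 / n * y) ^ (1 / r) = 1 / n * (x ^ (1 / q) * y ^ (1 / r)) := by
  rw [div_eq_mul_one_div x n, mul_comm (1 / n) y, Real.mul_rpow hx (by positivity),
    Real.mul_rpow hy (by positivity)]
  have : (1 / n) ^ (1 / q) * (1 / n) ^ (1 / r) = 1 / n := by
    rw [← Real.rpow_add (by positivity), add_comm, one_div_add_one_div_eq_one hr, Real.rpow_one]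
  linear_combination (x ^ (1 / q) * y ^ (1 / r)) * this

theorem lrBound_eq {r q : ℝ} (hr : r.HolderConjugate q) {n : ℕ} {a : Fin n → ℝ}
    (ha : ∀ i, 0 ≤ a i) (hn : 0 < n) (l : ℕ) :
    lrBound r a l = lrConst r * ((1 / (n : ℝ)) * (∑ i : Fin n with i.val < l, a i
      + (l : ℝ) ^ (1 / q) * (∑ i : Fin n with l ≤ i.val, a i ^ r) ^ (1 / r))) := by
  have hn0 : (0 : ℝ) < n := by exact_mod_cast hn
  unfold lrBound
  rw [hr.conjExponent_eq, rpow_mul_rpow_div hr hn0 (by positivity)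
    (Finset.sum_nonneg fun _ _ => by positivity), mul_add (1 / (n : ℝ))]
  simp only [abs_of_nonneg (ha _)]

theorem card_filter_val_lt {n l : ℕ} (hl : l ≤ n) :
    (Finset.univ.filter fun i : Fin n => i.val < l).card = l := by
  rw [Fin.card_filter_val_lt, min_eq_right hl]

theorem sum_filter_lt_add_sum_filter_le {n : ℕ} (f : Fin n → ℝ) (l : ℕ) :
    ∑ i : Fin n with i.val < l, f i + ∑ i : Fin n with l ≤ i.val, f i = ∑ i, f i := by
  rw [← Finset.sum_filter_add_sum_filter_not Finset.univ (fun i : Fin n => i.val < l) f]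
  simp only [not_lt]

theorem nat_mul_le_sum_filter {n : ℕ} {b : Fin n → ℝ} (hb : Antitone b) {l : ℕ} {i : Fin n}
    (hi : l ≤ i.val) : l * b i ≤ ∑ k : Fin n with k.val < l, b k := by
  have h : ∑ k : Fin n with k.val < l, b i ≤ ∑ k : Fin n with k.val < l, b k :=
    Finset.sum_le_sum fun k hk => hb (Fin.le_def.2 (by
      have := (Finset.mem_filter.1 hk).2
      omega))
  rwa [Finset.sum_const, card_filter_val_lt (hi.trans i.2.le), nsmul_eq_mul] at h

/-- Hölder's inequality on a tail: an upper bound for `∑ a_j s_j` in terms of `lrBound`. -/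
theorem lrConst_mul_mean_le_lrBound {r q : ℝ} (hr : r.HolderConjugate q) {n : ℕ} {a s : Fin n → ℝ}
    (ha : ∀ i, 0 ≤ a i) (h0 : ∀ j, 0 ≤ s j) (h1 : ∀ j, s j ≤ 1) (hn : 0 < n) {l : ℕ}
    (hs : ∑ j, s j ^ q ≤ l) :
    lrConst r * ((1 / (n : ℝ)) * ∑ j, a j * s j) ≤ lrBound r a l := by
  have hr0 := hr.pos
  have hq0 := hr.symm.pos
  rw [lrBound_eq hr ha hn, ← sum_filter_lt_add_sum_filter_le (fun j => a j * s j) l]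
  refine mul_le_mul_of_nonneg_left (mul_le_mul_of_nonneg_left (add_le_add ?_ ?_) (by positivity))
    (lrConst_pos hr).le
  · exact Finset.sum_le_sum fun j _ => mul_le_of_le_one_right (ha j) (h1 j)
  · refine (Real.inner_le_Lp_mul_Lq _ a s hr).trans ?_
    simp only [abs_of_nonneg (ha _), abs_of_nonneg (h0 _)]
    rw [mul_comm]
    refine mul_le_mul_of_nonneg_right (Real.rpow_le_rpow
      (Finset.sum_nonneg fun j _ => Real.rpow_nonneg (h0 j) q) (le_trans ?_ hs) (by positivity))
      (Real.rpow_nonneg (Finset.sum_nonneg fun j _ => Real.rpow_nonneg (ha j) r) _)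
    exact Finset.sum_le_sum_of_subset_of_nonneg (Finset.filter_subset _ _)
      fun j _ _ => Real.rpow_nonneg (h0 j) q

/-- The larger of the head and tail terms carries at least half of the bound. The indicator of the
first l indices realizes the head; the Hölder weights of the tail, scaled by l^{1/q}, realize the
tail. -/
theorem exists_lrBound_le {r q : ℝ} (hr : r.HolderConjugate q) {n : ℕ} {a : Fin n → ℝ}
    (ha : ∀ i, 0 ≤ a i) (hanti : Antitone a) (hn : 0 < n) {l : ℕ} (hl : l ≤ n) :
    ∃ s : Fin n → ℝ, (∀ j, 0 ≤ s j) ∧ (∀ j, s j ≤ 1) ∧ ∑ j, s j ^ q ≤ l ∧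
      lrBound r a l ≤ 2 * (lrConst r * ((1 / (n : ℝ)) * ∑ j, a j * s j)) := by
  have hr0 := hr.pos
  have hq0 := hr.symm.pos
  have hC := lrConst_pos hr
  rw [lrBound_eq hr ha hn]
  set A := ∑ i : Fin n with i.val < l, a i with hA
  set R := ∑ i : Fin n with l ≤ i.val, a i ^ r with hR
  have hR0 : 0 ≤ R := Finset.sum_nonneg fun j _ => Real.rpow_nonneg (ha j) r
  have reduce : ∀ B, A + (l : ℝ) ^ (1 / q) * R ^ (1 / r) ≤ 2 * B →
      lrConst r * ((1 / (n : ℝ)) * (A + (l : ℝ) ^ (1 / q) * R ^ (1 / r)))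
        ≤ 2 * (lrConst r * ((1 / (n : ℝ)) * B)) := fun B hB =>
    calc _ ≤ lrConst r * ((1 / (n : ℝ)) * (2 * B)) :=
          mul_le_mul_of_nonneg_left (mul_le_mul_of_nonneg_left hB (by positivity)) hC.le
      _ = _ := by ring
  have hcases : (l : ℝ) ^ (1 / q) * R ^ (1 / r) ≤ A
      ∨ 0 < R ∧ A ≤ (l : ℝ) ^ (1 / q) * R ^ (1 / r) := by
    rcases hR0.eq_or_lt with hz | hpos
    · left
      rw [← hz, Real.zero_rpow (by positivity), mul_zero]
      exact Finset.sum_nonneg fun j _ => ha j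
    · exact (le_total _ _).imp_right fun h => ⟨hpos, h⟩
  rcases hcases with hcase | ⟨hpos, hcase⟩
  · refine ⟨fun j => if j.val < l then 1 else 0, fun j => by dsimp only; split_ifs <;> norm_num,
      fun j => by dsimp only; split_ifs <;> norm_num, ?_, reduce _ ?_⟩
    · have : ∀ j : Fin n, (if j.val < l then (1 : ℝ) else 0) ^ q = if j.val < l then 1 else 0 :=
        fun j => by split_ifs <;> simp [Real.zero_rpow hq0.ne']
      simp only [this]
      rw [← Finset.sum_filter, Finset.sum_const, card_filter_val_lt hl]
      simp
    · simp only [mul_ite, mul_one, mul_zero]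
      rw [← Finset.sum_filter, ← hA]
      linarith
  · obtain ⟨w, h0, -, h2, h3, h4⟩ := exists_holder_weights hr
      (Finset.univ.filter fun i : Fin n => l ≤ i.val) (b := a) (fun i _ => ha i)
    rw [← hR] at h2 h4
    have hlq : (0 : ℝ) ≤ (l : ℝ) ^ (1 / q) := by positivity
    -- This makes the scaled weights at most 1. If it failed, l a_i would exceed the tail term,
    -- hence the head sum, although monotonicity gives l a_i ≤ A.
    have hsmall : ∀ i : Fin n, l ≤ i.val → l * a i ^ r ≤ R := by
      intro i hi
      by_contra hlt
      push Not at hlt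
      have hl0 : (0 : ℝ) < l := by
        rcases Nat.eq_zero_or_pos l with rfl | h
        · simp only [Nat.cast_zero, zero_mul] at hlt
          linarith
        · exact_mod_cast h
      have h5 : R ^ (1 / r) < ((l : ℝ) * a i ^ r) ^ (1 / r) :=
        Real.rpow_lt_rpow hR0 hlt (by positivity)
      rw [Real.mul_rpow (by positivity) (Real.rpow_nonneg (ha i) r), ← Real.rpow_mul (ha i),
        mul_one_div_cancel hr0.ne', Real.rpow_one] at h5
      have h6 := mul_lt_mul_of_pos_left h5 (Real.rpow_pos_of_pos hl0 (1 / q))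
      rw [← mul_assoc, ← Real.rpow_add hl0, add_comm, one_div_add_one_div_eq_one hr,
        Real.rpow_one] at h6
      have := nat_mul_le_sum_filter hanti hi
      linarith
    refine ⟨fun j => if l ≤ j.val then (l : ℝ) ^ (1 / q) * w j else 0, fun j => ?_, fun j => ?_,
      ?_, reduce _ ?_⟩
    · dsimp only
      split_ifs
      · exact mul_nonneg hlq (h0 j)
      · exact le_rfl
    · dsimp only
      split_ifs with hj
      · by_contra hlt
        push Not at hlt
        have h5 := Real.one_lt_rpow hlt hq0
        rw [Real.mul_rpow hlq (h0 j), ← Real.rpow_mul (by positivity),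
          one_div_mul_cancel hq0.ne', Real.rpow_one] at h5
        have h6 := h2 j (Finset.mem_filter.2 ⟨Finset.mem_univ _, hj⟩)
        have h7 := hsmall j hj
        rw [← h6, ← mul_assoc] at h7
        nlinarith
      · exact zero_le_one
    · have : ∀ j : Fin n, (if l ≤ j.val then (l : ℝ) ^ (1 / q) * w j else 0) ^ q
          = if l ≤ j.val then l * w j ^ q else 0 := fun j => by
        split_ifs
        · rw [Real.mul_rpow hlq (h0 j), ← Real.rpow_mul (by positivity),
            one_div_mul_cancel hq0.ne', Real.rpow_one]
        · exact Real.zero_rpow hq0.ne'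
      simp only [this]
      rw [← Finset.sum_filter, ← Finset.mul_sum]
      exact mul_le_of_le_one_right (by positivity) h3
    · simp only [mul_ite, mul_zero]
      rw [← Finset.sum_filter]
      simp only [mul_left_comm (a _)]
      rw [← Finset.mul_sum, h4]
      linarith

theorem permAverage_mul_of_nonneg {r : ℝ} (hr : 0 < r) {n : ℕ} {a x : Fin n → ℝ}
    (hx : ∀ i, 0 ≤ x i) {c : ℝ} (hc : 0 ≤ c) :
    permAverage r a (fun i => c * x i) = c * permAverage r a x := by
  simpa only [abs_of_nonneg (hx _)] using permAverage_mul hr a x hc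

theorem lrBound_nonneg {r q : ℝ} (hr : r.HolderConjugate q) {n : ℕ} {a : Fin n → ℝ}
    (ha : ∀ i, 0 ≤ a i) (hn : 0 < n) (l : ℕ) : 0 ≤ lrBound r a l := by
  have := lrConst_mul_mean_le_lrBound hr (s := fun _ => 0) ha (fun _ => le_rfl)
    (fun _ => zero_le_one) hn (l := l) (by simp [Real.zero_rpow hr.symm.ne_zero])
  simpa using this

theorem lrBound_self {r q : ℝ} (hr : r.HolderConjugate q) {n : ℕ} {a : Fin n → ℝ}
    (ha : ∀ i, 0 ≤ a i) (hn : 0 < n) :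
    lrBound r a n = lrConst r * ((1 / (n : ℝ)) * ∑ i, a i) := by
  rw [lrBound_eq hr ha hn, ← sum_filter_lt_add_sum_filter_le a n]
  have : (Finset.univ.filter fun i : Fin n => n ≤ i.val) = ∅ :=
    Finset.filter_eq_empty_iff.2 fun i _ => by have := i.2; omega
  have hr0 := hr.pos
  simp [this, Real.zero_rpow (inv_ne_zero hr0.ne')]

theorem lrBound_one_le {r q : ℝ} (hr : r.HolderConjugate q) {n : ℕ} {a : Fin n → ℝ}
    (ha : ∀ i, 0 ≤ a i) (hn : 0 < n) :
    lrBound r a 1 ≤ 2 * (lrConst r * ((1 / (n : ℝ)) * (∑ i, a i ^ r) ^ (1 / r))) := by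
  have hr0 := hr.pos
  have har : ∀ i, 0 ≤ a i ^ r := fun i => Real.rpow_nonneg (ha i) r
  have h1 : ∑ i : Fin n with i.val < 1, a i ≤ (∑ i, a i ^ r) ^ (1 / r) := by
    have e : (Finset.univ.filter fun i : Fin n => i.val < 1) = {⟨0, hn⟩} := by
      ext i
      simp [Fin.ext_iff]
    rw [e, Finset.sum_singleton]
    calc a ⟨0, hn⟩ = (a ⟨0, hn⟩ ^ r) ^ (1 / r) := by
          rw [← Real.rpow_mul (ha _), mul_one_div_cancel hr0.ne', Real.rpow_one]
      _ ≤ _ := Real.rpow_le_rpow (har _)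
        (Finset.single_le_sum (fun i _ => har i) (Finset.mem_univ _)) (by positivity)
  have h2 : (∑ i : Fin n with 1 ≤ i.val, a i ^ r) ^ (1 / r) ≤ (∑ i, a i ^ r) ^ (1 / r) :=
    Real.rpow_le_rpow (Finset.sum_nonneg fun i _ => har i)
      (Finset.sum_le_sum_of_subset_of_nonneg (Finset.filter_subset _ _) fun i _ _ => har i)
      (by positivity)
  rw [lrBound_eq hr ha hn, Nat.cast_one, Real.one_rpow, one_mul]
  calc _ ≤ lrConst r * ((1 / (n : ℝ)) * (2 * (∑ i, a i ^ r) ^ (1 / r))) :=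
        mul_le_mul_of_nonneg_left (mul_le_mul_of_nonneg_left (by linarith) (by positivity))
          (lrConst_pos hr).le
    _ = _ := by ring

theorem sum_mul_rpow_sum_le {r q : ℝ} (hr : r.HolderConjugate q) {n : ℕ} {a x : Fin n → ℝ}
    (ha : ∀ i, 0 ≤ a i) (hx : ∀ i, 0 ≤ x i) :
    ∑ i, x i * (lrConst r * ((1 / (n : ℝ)) * (∑ i, a i ^ r) ^ (1 / r)))
      ≤ 2 * permAverage r a x := by
  have h := mean_mul_rpow_sum_le_permAverage hr ha hx
  rw [← Finset.sum_mul]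
  calc _ = lrConst r * ((1 / (n : ℝ)) * (∑ i, x i) * (∑ j, a j ^ r) ^ (1 / r)) := by ring
    _ ≤ lrConst r * permAverage r a x := mul_le_mul_of_nonneg_left h (lrConst_pos hr).le
    _ ≤ _ := mul_le_mul_of_nonneg_right (lrConst_le_two hr) (permAverage_nonneg r a x)

/-- The lower half of the grid bounds controls `avgKernel`. -/
theorem avgKernel_le_of_lrBound_le {r q : ℝ} (hr : r.HolderConjugate q) {n : ℕ} {a : Fin n → ℝ}
    (ha : ∀ i, 0 ≤ a i) (hn : 0 < n) {N : ℝ → ℝ} (hN : IsDegenerateOrlicz N)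
    (h : ∀ l : ℕ, 1 ≤ l → l ≤ n → lrBound r a l ≤ 8 * orliczDualInv N ((l : ℝ) / n))
    {t : ℝ} (ht : 0 ≤ t) : avgKernel q a t ≤ N (8 * t) + 1 / n := by
  have hq0 := hr.symm.pos
  have hn0 : (0 : ℝ) < n := by exact_mod_cast hn
  choose s h0 h1 hs _ using fun j => dualKernel_attained hq0 (a j * t)
  set v := ∑ j, s j ^ q with hv
  have hv0 : 0 ≤ v := Finset.sum_nonneg fun j _ => Real.rpow_nonneg (h0 j) q
  have hvn : v ≤ n := by
    have : v ≤ ∑ _j : Fin n, (1 : ℝ) :=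
      Finset.sum_le_sum fun j _ => Real.rpow_le_one (h0 j) (h1 j) hq0.le
    simpa using this
  -- Rounding the mass v up to a positive integer costs at most 1, which becomes the error 1/n.
  obtain ⟨l, hl1, hln, hvl, hlv⟩ : ∃ l : ℕ, 1 ≤ l ∧ l ≤ n ∧ v ≤ l ∧ (l : ℝ) ≤ v + 1 := by
    refine ⟨max 1 ⌈v⌉₊, le_max_left _ _, max_le hn (Nat.ceil_le.2 hvn),
      (Nat.le_ceil v).trans (by exact_mod_cast le_max_right _ _), ?_⟩
    rw [Nat.cast_max, Nat.cast_one]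
    exact max_le (by linarith) (Nat.ceil_lt_add_one hv0).le
  have e : avgKernel q a t = t * ((1 / (n : ℝ)) * ∑ j, a j * s j) - v / n := by
    rw [avgKernel, Finset.sum_congr rfl fun j _ => hs j, Finset.sum_sub_distrib, ← hv, mul_sub,
      mul_left_comm t, Finset.mul_sum (a := t), one_div_mul_eq_div (n : ℝ) v]
    simp only [mul_comm, mul_left_comm]
  have hB : (1 / (n : ℝ)) * ∑ j, a j * s j ≤ 8 * orliczDualInv N ((l : ℝ) / n) := by
    have hB0 : 0 ≤ (1 / (n : ℝ)) * ∑ j, a j * s j :=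
      mul_nonneg (by positivity) (Finset.sum_nonneg fun j _ => mul_nonneg (ha j) (h0 j))
    exact (le_mul_of_one_le_left hB0 (one_le_lrConst hr)).trans
      ((lrConst_mul_mean_le_lrBound hr ha h0 h1 hn hvl).trans (h l hl1 hln))
  have hg := orliczDualInv_mul_le hN (u := (l : ℝ) / n) (t := 8 * t) (by positivity)
    (by positivity)
  have h2 := mul_le_mul_of_nonneg_left hB ht
  have h3 : (l : ℝ) / n ≤ v / n + 1 / n := by
    rw [← add_div]
    gcongr
  rw [e]
  linarith

/-- The upper half of the grid bounds controls `N` on the relevant range. -/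
theorem le_avgKernel_of_le_lrBound {r q : ℝ} (hr : r.HolderConjugate q) {n : ℕ} {a : Fin n → ℝ}
    (ha : ∀ i, 0 ≤ a i) (hanti : Antitone a) (hn : 0 < n) {N : ℝ → ℝ} (hN : IsDegenerateOrlicz N)
    (h : ∀ l : ℕ, 1 ≤ l → l ≤ n → orliczDualInv N ((l : ℝ) / n) ≤ lrBound r a l)
    {t : ℝ} (ht : 0 ≤ t) (ht1 : t * lrBound r a n ≤ 1) :
    N t ≤ t * lrBound r a 1 + avgKernel q a (4 * lrConst r * t) / 2 := by
  have hq0 := hr.symm.pos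
  have hn0 : (0 : ℝ) < n := by exact_mod_cast hn
  have hC := lrConst_pos hr
  have hA := avgKernel_nonneg hq0 a (4 * lrConst r * t)
  have hB := mul_nonneg ht (lrBound_nonneg hr ha hn 1)
  rcases ht.eq_or_lt with rfl | ht
  · rw [hN.map_zero]
    linarith
  obtain ⟨s, u, hs0, hu0, hst, hsu⟩ := hN.exists_eq_orliczDualInv ht
  -- The supporting line at t has slope s and height -u. Heights u ≤ 1/n give the linear term, 1/n <
  -- u ≤ 1 the kernel term, and for u > 1 the range restriction on t forces N t ≤ 0.
  rcases le_or_gt (u * n) 1 with hu1 | hu1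
  · have h1 : s ≤ lrBound r a 1 := by
      refine le_trans (le_orliczDualInv hN (by positivity) hs0 fun y hy => (hsu y hy).trans ?_)
        (h 1 le_rfl hn)
      rw [le_div_iff₀ hn0]
      simpa using hu1
    have := mul_le_mul_of_nonneg_right h1 ht.le
    linarith
  rcases le_or_gt u 1 with hu2 | hu2
  · set l := ⌈u * n⌉₊ with hl
    have hul : u * n ≤ l := Nat.le_ceil _
    have hlu : (l : ℝ) < u * n + 1 := Nat.ceil_lt_add_one (by positivity)
    have hl1 : 1 ≤ l := Nat.one_le_iff_ne_zero.2 fun h0 => by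
      rw [h0, Nat.cast_zero] at hul
      linarith
    have hln : l ≤ n := Nat.ceil_le.2 (mul_le_of_le_one_left hn0.le hu2)
    have h1 : s ≤ lrBound r a l := by
      refine le_trans (le_orliczDualInv hN (by positivity) hs0 fun y hy => (hsu y hy).trans ?_)
        (h l hl1 hln)
      rwa [le_div_iff₀ hn0]
    obtain ⟨w, w0, w1, hw, hwl⟩ := exists_lrBound_le hr ha hanti hn hln
    have h2 := le_avgKernel hq0 a (4 * lrConst r * t) w0 w1
    -- Since un > 1, rounding up at most doubles the mass. The factor 4 and the final halving turn
    -- this 2u back into u.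
    have h3 : (1 / (n : ℝ)) * ∑ j, w j ^ q ≤ 2 * u := by
      rw [one_div_mul_eq_div, div_le_iff₀ hn0]
      linarith
    have h4 := mul_le_mul_of_nonneg_left (h1.trans hwl) ht.le
    linarith
  -- Scaling the line by 1/u ≤ 1 keeps it below N, since N ≥ 0, and brings its height to -1, the
  -- last grid point.
  · have h1 : s / u ≤ lrBound r a n := by
      refine le_trans (le_orliczDualInv hN zero_le_one (by positivity) fun y hy => ?_)
        (le_trans (le_of_eq ?_) (h n hn le_rfl))
      · have h2 := hsu y hy
        have h3 := hN.nonneg y hy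
        rw [sub_le_iff_le_add, div_mul_eq_mul_div, div_le_iff₀ (by linarith)]
        nlinarith
      · rw [div_self hn0.ne']
    rw [div_le_iff₀ (by linarith)] at h1
    have h2 := mul_le_mul_of_nonneg_right h1 ht.le
    nlinarith

/-- For a mean below 1/16 the linear term sums to at most 4/16, and C ≤ 2 keeps the dilated mean
4C/16 within the 1/2 allowed by `sum_avgKernel_le_one`. Conversely, after dilation by 1/8 the
kernels sum to at most 1 + n · (1/n), so the mean is at most 8 · (1 + 2). -/
theorem permAverage_equiv_of_grid_bounds {r q : ℝ} (hr : r.HolderConjugate q) {n : ℕ}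
    {a : Fin n → ℝ} (ha : ∀ i, 0 ≤ a i) (hanti : Antitone a) {N : ℝ → ℝ}
    (hN : IsDegenerateOrlicz N)
    (h : ∀ l : ℕ, 1 ≤ l → l ≤ n → orliczDualInv N ((l : ℝ) / n) ≤ lrBound r a l ∧
      lrBound r a l ≤ 8 * orliczDualInv N ((l : ℝ) / n)) (x : Fin n → ℝ) :
    1 / 16 * orliczNorm N x ≤ permAverage r a x ∧
      permAverage r a x ≤ 24 * orliczNorm N x := by
  have hr0 := hr.pos
  have hC := lrConst_pos hr
  have hC2 := lrConst_le_two hr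
  have hlow : ∀ x : Fin n → ℝ, (∀ i, 0 ≤ x i) → permAverage r a x < 1 / 16 →
      ∑ i, N (x i) ≤ 1 := by
    intro x hx hxa
    rcases Nat.eq_zero_or_pos n with rfl | hn
    · simp
    have hP := permAverage_nonneg r a x
    have h1 : ∑ i, N (x i) ≤ ∑ i, (x i * lrBound r a 1
        + avgKernel q a (4 * lrConst r * x i) / 2) := by
      refine Finset.sum_le_sum fun i _ => le_avgKernel_of_le_lrBound hr ha hanti hn hN
        (fun l h1 h2 => (h l h1 h2).1) (hx i) ?_
      have := mul_mean_le_permAverage hr0 (a := a) (x := x) i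
      rw [lrBound_self hr ha hn, mul_left_comm]
      nlinarith
    rw [Finset.sum_add_distrib, ← Finset.sum_div] at h1
    have h2 : ∑ i, x i * lrBound r a 1 ≤ 4 * permAverage r a x := by
      calc _ ≤ ∑ i, 2 * (x i * (lrConst r * ((1 / (n : ℝ)) * (∑ i, a i ^ r) ^ (1 / r)))) :=
            Finset.sum_le_sum fun i _ => by
              have := mul_le_mul_of_nonneg_left (lrBound_one_le hr ha hn) (hx i)
              linarith
        _ ≤ _ := by
          rw [← Finset.mul_sum]
          have := sum_mul_rpow_sum_le hr ha hx
          linarith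
    have h3 := sum_avgKernel_le_one hr (x := fun i => 4 * lrConst r * x i) ha
      (fun i => mul_nonneg (by positivity) (hx i)) (by
        rw [permAverage_mul_of_nonneg hr0 hx (by positivity)]
        nlinarith)
    linarith
  have key := orliczNorm_le_permAverage hr0 (by norm_num) hlow x
  refine ⟨key.2, permAverage_le_orliczNorm hr0 (by norm_num) (fun x hx hxN => ?_) x
    (key.1 (permAverage r a x / (1 / 16) + 1) (by linarith))⟩
  have h1 := permAverage_le_of_forall (c := 1) (α := 1) (β := 1) ha
    (x := fun i => 1 / 8 * x i) (fun i => mul_nonneg (by norm_num) (hx i)) (fun y hy => by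
      simpa using rpow_sum_le_one_add hr hy)
  rw [permAverage_mul_of_nonneg hr0 hx (by norm_num)] at h1
  have h2 : ∑ i, avgKernel q a (1 * (1 / 8 * x i)) ≤ 2 := by
    rcases Nat.eq_zero_or_pos n with rfl | hn
    · simp
    have hn0 : (0 : ℝ) < n := by exact_mod_cast hn
    calc _ ≤ ∑ i, (N (x i) + 1 / n) := Finset.sum_le_sum fun i _ => by
          have := avgKernel_le_of_lrBound_le hr ha hn hN (fun l h1 h2 => (h l h1 h2).2)
            (t := 1 * (1 / 8 * x i)) (by linarith [hx i])
          rwa [show 8 * (1 * (1 / 8 * x i)) = x i by ring] at this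
      _ ≤ 2 := by
        rw [Finset.sum_add_distrib, Finset.sum_const, Finset.card_univ, Fintype.card_fin,
          nsmul_eq_mul, mul_one_div_cancel hn0.ne']
        linarith
  linarith

/-! ### The equality case of Young's inequality -/

/-- Young's inequality is an equality at s^q = (r - 1) y^r. -/
theorem lrConst_mul_rpow_mul_eq {r q : ℝ} (hr : r.HolderConjugate q) {y : ℝ} (hy : 0 ≤ y) :
    lrConst r * (((r - 1) * y ^ r) ^ (1 / q) * y) = r * y ^ r := by
  have hr0 := hr.pos
  have hq0 := hr.symm.pos
  have hr1 := hr.sub_one_pos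
  have h1 : lrConst r * (r - 1) ^ (1 / q) = r := by
    rw [lrConst_eq hr, mul_assoc, ← Real.mul_rpow hq0.le hr1.le, mul_comm q,
      hr.sub_one_mul_conj, ← Real.rpow_add hr0, one_div_add_one_div_eq_one hr, Real.rpow_one]
  have h2 : y ^ (r - 1) * y = y ^ r := by
    rcases hy.eq_or_lt with rfl | hy
    · rw [mul_zero, Real.zero_rpow hr0.ne']
    · nth_rw 2 [← Real.rpow_one y]
      rw [← Real.rpow_add hy, sub_add_cancel]
  rw [Real.mul_rpow hr1.le (by positivity), ← Real.rpow_mul hy, mul_one_div r q,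
    hr.div_conj_eq_sub_one]
  linear_combination (lrConst r * (r - 1) ^ (1 / q)) * h2 + y ^ r * h1

theorem mul_lrConst_mul_le {r q : ℝ} (hr : r.HolderConjugate q) {τ u A : ℝ} (hτ : 0 ≤ τ)
    (hu : 0 ≤ u) (hA : 0 ≤ A) :
    τ * (lrConst r * (u ^ (1 / q) * A ^ (1 / r))) ≤ u + τ ^ r * A := by
  have h := lrConst_mul_le hr (s := u ^ (1 / q)) (y := τ * A ^ (1 / r)) (by positivity)
    (by positivity)
  rw [Real.mul_rpow hτ (by positivity), ← Real.rpow_mul hA, ← Real.rpow_mul hu,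
    one_div_mul_cancel hr.ne_zero, one_div_mul_cancel hr.symm.ne_zero, Real.rpow_one,
    Real.rpow_one] at h
  linarith

/-- Together with `mul_lrConst_mul_le`: C u^{1/q} A^{1/r} is the minimum over τ > 0 of (u + τ^r
A)/τ, attained where (r - 1) τ^r A = u. -/
theorem exists_mul_lrConst_mul_eq {r q : ℝ} (hr : r.HolderConjugate q) {u A : ℝ}
    (hu : 0 < u) (hA : 0 < A) :
    ∃ τ, 0 < τ ∧ (r - 1) * (τ ^ r * A) = u ∧
      τ * (lrConst r * (u ^ (1 / q) * A ^ (1 / r))) = u + τ ^ r * A := by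
  have hr0 := hr.pos
  have hr1 := hr.sub_one_pos
  refine ⟨(u / ((r - 1) * A)) ^ (1 / r), by positivity, ?_⟩
  set τ := (u / ((r - 1) * A)) ^ (1 / r) with hτdef
  have hτ : 0 ≤ τ := by positivity
  have h1 : (r - 1) * (τ ^ r * A) = u := by
    rw [hτdef, ← Real.rpow_mul (by positivity), one_div_mul_cancel hr0.ne', Real.rpow_one]
    field_simp
  refine ⟨h1, ?_⟩
  have h2 := lrConst_mul_rpow_mul_eq hr (y := τ * A ^ (1 / r)) (by positivity)
  rw [Real.mul_rpow hτ (by positivity), ← Real.rpow_mul hA.le, one_div_mul_cancel hr0.ne',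
    Real.rpow_one, h1] at h2
  linarith

theorem mul_rpow_le_lrConst_mul {r q : ℝ} (hr : r.HolderConjugate q) {y : ℝ} (hy : 0 ≤ y)
    (h : (r - 1) * y ^ r ≤ 1) : r * y ^ r ≤ lrConst r * y := by
  have hr1 := hr.sub_one_pos
  rw [← lrConst_mul_rpow_mul_eq hr hy]
  refine mul_le_mul_of_nonneg_left (mul_le_of_le_one_left hy ?_) (lrConst_pos hr).le
  exact Real.rpow_le_one (by positivity) h (one_div_nonneg.2 hr.symm.nonneg)

/-- Weighted AM-GM in which the points 1/r, 1/q are also the weights; their geometric mean is 1/C_r.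
-/
theorem one_le_lrConst_mul_sq_add_sq {r q : ℝ} (hr : r.HolderConjugate q) :
    1 ≤ lrConst r * ((1 / r) ^ 2 + (1 / q) ^ 2) := by
  have hr0 := hr.pos
  have hq0 := hr.symm.pos
  have h := Real.geom_mean_le_arith_mean2_weighted (w₁ := 1 / r) (w₂ := 1 / q) (p₁ := 1 / r)
    (p₂ := 1 / q) (by positivity) (by positivity) (by positivity) (by positivity)
    (one_div_add_one_div_eq_one hr)
  have e : lrConst r * ((1 / r) ^ (1 / r) * (1 / q) ^ (1 / q)) = 1 := by
    rw [lrConst_eq hr, Real.div_rpow zero_le_one hr0.le, Real.div_rpow zero_le_one hq0.le,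
      Real.one_rpow, Real.one_rpow]
    have := Real.rpow_pos_of_pos hr0 (1 / r)
    have := Real.rpow_pos_of_pos hq0 (1 / q)
    field_simp
  have h1 := mul_le_mul_of_nonneg_left h (lrConst_pos hr).le
  rw [e] at h1
  rwa [sq, sq]

theorem rpow_sum_le_inv_lrConst {r q : ℝ} (hr : r.HolderConjugate q) {n : ℕ} {y : Fin n → ℝ}
    (hy : ∀ i, 0 ≤ y i) :
    (∑ i, y i ^ r) ^ (1 / r)
      ≤ 1 / lrConst r + 1 / lrConst r * ∑ i, dualKernel q (lrConst r * y i) := by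
  have hC := lrConst_pos hr
  have h := rpow_sum_le_one_add hr (y := fun i => lrConst r * y i)
    (fun i => mul_nonneg hC.le (hy i))
  rw [Finset.sum_congr rfl fun i _ => Real.mul_rpow hC.le (hy i), ← Finset.mul_sum,
    Real.mul_rpow (by positivity) (Finset.sum_nonneg fun i _ => Real.rpow_nonneg (hy i) r),
    ← Real.rpow_mul hC.le, mul_one_div_cancel hr.ne_zero, Real.rpow_one] at h
  rw [← mul_one_add, one_div_mul_eq_div, le_div_iff₀' hC]
  exact h

/-- For r ≤ 2 the bound is 1/q + (1/r)(1 + 1/r) = 1 + 1/r² < 2. For r > 2 it is (2 + p)/C with p =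
1/r < 1/2, and 1/C ≤ p² + (1 - p)² makes it less than 2. -/
theorem exists_lt_one_permAverage_le {r q : ℝ} (hr : r.HolderConjugate q) :
    ∃ σ : ℝ, 1 / 2 ≤ σ ∧ σ < 1 ∧ ∀ (n : ℕ) (a x : Fin n → ℝ), (∀ i, 0 ≤ a i) → (∀ i, 0 ≤ x i) →
      ∑ i, avgKernel q a (lrConst r * x i) ≤ 1 + 1 / r → permAverage r a x ≤ 2 * σ := by
  have hr0 := hr.pos
  have hq0 := hr.symm.pos
  have hC := lrConst_pos hr
  have hpq := one_div_add_one_div_eq_one hr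
  have hp : 0 < 1 / r := by positivity
  have hq : 0 < 1 / q := by positivity
  obtain ⟨α, β, hβ, hK, hy⟩ : ∃ α β : ℝ, 0 ≤ β ∧ α + β * (1 + 1 / r) < 2 ∧
      ∀ (n : ℕ) (y : Fin n → ℝ), (∀ i, 0 ≤ y i) →
        (∑ i, y i ^ r) ^ (1 / r) ≤ α + β * ∑ i, dualKernel q (lrConst r * y i) := by
    rcases le_or_gt r 2 with h2 | h2
    · exact ⟨1 / q, 1 / r, hp.le, by nlinarith, fun n y hy => rpow_sum_le_of_le_two hr h2 hy⟩
    · refine ⟨1 / lrConst r, 1 / lrConst r, by positivity, ?_,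
        fun n y hy => rpow_sum_le_inv_lrConst hr hy⟩
      have h3 := one_le_lrConst_mul_sq_add_sq hr
      have h4 : 1 / r < 1 / 2 := one_div_lt_one_div_of_lt two_pos h2
      rw [← mul_one_add, one_div_mul_eq_div, div_lt_iff₀ hC]
      have h5 : 1 / q = 1 - 1 / r := by linarith
      rw [h5] at h3
      set p := 1 / r
      have h6 : (1 + (1 + p)) * (p ^ 2 + (1 - p) ^ 2) < 2 := by nlinarith [mul_pos hp hp]
      have h7 : 0 < p ^ 2 + (1 - p) ^ 2 := by nlinarith
      nlinarith
  refine ⟨max (1 / 2) ((α + β * (1 + 1 / r)) / 2), le_max_left _ _,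
    max_lt (by norm_num) (by linarith), fun n a x ha hx h => ?_⟩
  have h1 := permAverage_le_of_forall ha hx (hy n)
  have h2 := mul_le_mul_of_nonneg_left h hβ
  have h3 := le_max_right (1 / 2) ((α + β * (1 + 1 / r)) / 2)
  linarith

/-! ### The fine grid -/

theorem lrFineBound_eq {r q : ℝ} (hr : r.HolderConjugate q) {n : ℕ} {a : Fin n → ℝ}
    (ha : ∀ i, 0 ≤ a i) (l : ℕ) :
    lrFineBound r a l = lrConst r * ((1 / (n : ℝ)) * (((l : ℝ) / n) ^ (1 / q)
      * (∑ i : Fin n with i.val < l, a i ^ r) ^ (1 / r))) := by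
  unfold lrFineBound
  rw [hr.conjExponent_eq]
  simp only [abs_of_nonneg (ha _), mul_assoc]

theorem lrFineBound_mono {r q : ℝ} (hr : r.HolderConjugate q) {n : ℕ} {a : Fin n → ℝ}
    (ha : ∀ i, 0 ≤ a i) {l m : ℕ} (hlm : l ≤ m) : lrFineBound r a l ≤ lrFineBound r a m := by
  have hr0 := hr.pos
  have hq0 := hr.symm.pos
  have hC := lrConst_pos hr
  have har : ∀ i, 0 ≤ a i ^ r := fun i => Real.rpow_nonneg (ha i) r
  rw [lrFineBound_eq hr ha, lrFineBound_eq hr ha]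
  have h1 : ∑ i : Fin n with i.val < l, a i ^ r ≤ ∑ i : Fin n with i.val < m, a i ^ r :=
    Finset.sum_le_sum_of_subset_of_nonneg
      (Finset.monotone_filter_right _ fun i _ (hi : i.val < l) => hi.trans_le hlm)
      fun i _ _ => har i
  have h0 : 0 ≤ ∑ i : Fin n with i.val < l, a i ^ r := Finset.sum_nonneg fun i _ => har i
  have h2 : (l : ℝ) ≤ m := by exact_mod_cast hlm
  gcongr

theorem lrFineBound_self {r q : ℝ} (hr : r.HolderConjugate q) {n : ℕ} {a : Fin n → ℝ}
    (ha : ∀ i, 0 ≤ a i) (hn : 0 < n) :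
    lrFineBound r a n = lrConst r * ((1 / (n : ℝ)) * (∑ i, a i ^ r) ^ (1 / r)) := by
  have hn0 : (n : ℝ) ≠ 0 := by exact_mod_cast hn.ne'
  rw [lrFineBound_eq hr ha, div_self hn0, Real.one_rpow, one_mul]
  simp

theorem lrFineBound_pos {r q : ℝ} (hr : r.HolderConjugate q) {n : ℕ} {a : Fin n → ℝ}
    (ha : ∀ i, 0 < a i) (hn : 0 < n) {l : ℕ} (hl : 1 ≤ l) : 0 < lrFineBound r a l := by
  have hC := lrConst_pos hr
  have hn0 : (0 : ℝ) < n := by exact_mod_cast hn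
  have hl0 : (0 : ℝ) < l := by exact_mod_cast hl
  have h : 0 < ∑ i : Fin n with i.val < l, a i ^ r :=
    Finset.sum_pos (fun i _ => Real.rpow_pos_of_pos (ha i) r) ⟨⟨0, hn⟩, by simp; omega⟩
  rw [lrFineBound_eq hr fun i => (ha i).le]
  positivity

theorem lrFineBound_one_le_lrBound {r q : ℝ} (hr : r.HolderConjugate q) {n : ℕ} {a : Fin n → ℝ}
    (ha : ∀ i, 0 ≤ a i) (hn : 0 < n) {l : ℕ} (hl : 1 ≤ l) :
    lrFineBound r a 1 ≤ lrBound r a l := by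
  have hr0 := hr.pos
  have hq0 := hr.symm.pos
  have hn1 : (1 : ℝ) ≤ n := by exact_mod_cast hn
  have e : (Finset.univ.filter fun i : Fin n => i.val < 1) = {⟨0, hn⟩} := by
    ext i
    simp [Fin.ext_iff]
  rw [lrFineBound_eq hr ha, lrBound_eq hr ha hn, e, Finset.sum_singleton, ← Real.rpow_mul (ha _),
    mul_one_div_cancel hr0.ne', Real.rpow_one]
  refine mul_le_mul_of_nonneg_left (mul_le_mul_of_nonneg_left ?_ (by positivity))
    (lrConst_pos hr).le
  have h1 : ((1 : ℕ) / (n : ℝ)) ^ (1 / q) ≤ 1 :=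
    Real.rpow_le_one (by positivity) (by rw [Nat.cast_one]; exact (div_le_one (by linarith)).2 hn1)
      (by positivity)
  have h2 : a ⟨0, hn⟩ ≤ ∑ i : Fin n with i.val < l, a i :=
    Finset.single_le_sum (f := a) (fun i _ => ha i) (by simp; omega)
  have h3 : 0 ≤ (l : ℝ) ^ (1 / q) * (∑ i : Fin n with l ≤ i.val, a i ^ r) ^ (1 / r) :=
    mul_nonneg (by positivity)
      (Real.rpow_nonneg (Finset.sum_nonneg fun i _ => Real.rpow_nonneg (ha i) r) _)
  have h4 := mul_le_of_le_one_left (ha ⟨0, hn⟩) h1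
  linarith

/-- The test vector is (l/n)^{1/q} times the Hölder weights of the first l entries; its mean q-th
power is at most l/n². -/
theorem mul_lrFineBound_sub_le {r q : ℝ} (hr : r.HolderConjugate q) {n : ℕ} {a : Fin n → ℝ}
    (ha : ∀ i, 0 ≤ a i) (hn : 0 < n) {l : ℕ} (hl : l ≤ n) (t : ℝ) :
    t * lrFineBound r a l - (l : ℝ) / (n : ℝ) ^ 2 ≤ avgKernel q a (lrConst r * t) := by
  have hr0 := hr.pos
  have hq0 := hr.symm.pos
  have hn0 : (0 : ℝ) < n := by exact_mod_cast hn
  have hln : (l : ℝ) / n ≤ 1 := (div_le_one hn0).2 (by exact_mod_cast hl)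
  obtain ⟨w, h0, h1, -, h2, h3⟩ := exists_holder_weights hr
    (Finset.univ.filter fun i : Fin n => i.val < l) (b := a) (fun i _ => ha i)
  set c := ((l : ℝ) / n) ^ (1 / q) with hc
  have hc0 : 0 ≤ c := by positivity
  have hc1 : c ≤ 1 := Real.rpow_le_one (by positivity) hln (by positivity)
  have hcq : c ^ q = (l : ℝ) / n := by
    rw [hc, ← Real.rpow_mul (by positivity), one_div_mul_cancel hq0.ne', Real.rpow_one]
  have h := le_avgKernel hq0 a (lrConst r * t) (s := fun j => if j.val < l then c * w j else 0)
    (fun j => by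
      split_ifs
      · exact mul_nonneg hc0 (h0 j)
      · exact le_rfl)
    (fun j => by
      split_ifs with hj
      · exact mul_le_one₀ hc1 (h0 j) (h1 j (by simpa using hj))
      · exact zero_le_one)
  have e1 : ∑ j, a j * (if j.val < l then c * w j else 0)
      = c * (∑ i : Fin n with i.val < l, a i ^ r) ^ (1 / r) := by
    simp only [mul_ite, mul_zero]
    rw [← Finset.sum_filter, ← h3, Finset.mul_sum]
    exact Finset.sum_congr rfl fun j _ => by ring
  have e2 : ∑ j : Fin n, (if j.val < l then c * w j else 0) ^ q
      = (l : ℝ) / n * ∑ j : Fin n with j.val < l, w j ^ q := by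
    have : ∀ j : Fin n, (if j.val < l then c * w j else 0) ^ q
        = if j.val < l then (l : ℝ) / n * w j ^ q else 0 := fun j => by
      split_ifs
      · rw [Real.mul_rpow hc0 (h0 j), hcq]
      · exact Real.zero_rpow hq0.ne'
    simp only [this]
    rw [← Finset.sum_filter, Finset.mul_sum]
  rw [e1, e2] at h
  have h4 : (1 / (n : ℝ)) * ((l : ℝ) / n * ∑ j : Fin n with j.val < l, w j ^ q)
      ≤ (l : ℝ) / (n : ℝ) ^ 2 := by
    calc _ ≤ (1 / (n : ℝ)) * ((l : ℝ) / n * 1) := by gcongr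
      _ = _ := by field_simp
  rw [lrFineBound_eq hr ha]
  linarith

/-- Partial sums of a decreasing sequence are concave in their length, with the l-th entry as a
supergradient at l. -/
theorem sum_filter_lt_le_add {n : ℕ} {b : Fin n → ℝ} (hb : Antitone b) {j l : ℕ} (hj : j ≤ n)
    (hl1 : 1 ≤ l) (hl : l ≤ n) :
    ∑ i : Fin n with i.val < j, b i
      ≤ ∑ i : Fin n with i.val < l, b i + ((j : ℝ) - l) * b ⟨l - 1, by omega⟩ := by
  set β := b ⟨l - 1, by omega⟩ with hβ
  have key : ∀ i : Fin n, (if i.val < j then (b i - β) else 0)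
      ≤ if i.val < l then (b i - β) else 0 := by
    intro i
    have h1 : i.val < l → β ≤ b i := fun h => hb (Fin.le_def.2 (by
      change i.val ≤ l - 1
      omega))
    have h2 : l ≤ i.val → b i ≤ β := fun h => hb (Fin.le_def.2 (by
      change l - 1 ≤ i.val
      omega))
    split_ifs with h3 h4 h4
    · exact le_rfl
    · have := h2 (by omega)
      linarith
    · have := h1 h4
      linarith
    · exact le_rfl
  have h := Finset.sum_le_sum fun i (_ : i ∈ Finset.univ) => key i
  rw [← Finset.sum_filter, ← Finset.sum_filter, Finset.sum_sub_distrib, Finset.sum_sub_distrib,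
    Finset.sum_const, Finset.sum_const, card_filter_val_lt hj, card_filter_val_lt hl,
    nsmul_eq_mul, nsmul_eq_mul] at h
  linarith

theorem avgKernel_le_rpow {r q : ℝ} (hr : r.HolderConjugate q) {n : ℕ} {a : Fin n → ℝ}
    (ha : ∀ i, 0 ≤ a i) {t : ℝ} (ht : 0 ≤ t) :
    avgKernel q a (lrConst r * t) ≤ t ^ r * ((1 / (n : ℝ)) * ∑ i, a i ^ r) := by
  unfold avgKernel
  rw [mul_left_comm]
  refine mul_le_mul_of_nonneg_left ?_ (by positivity)
  rw [Finset.mul_sum]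
  refine Finset.sum_le_sum fun j _ => ?_
  rw [mul_left_comm, ← Real.mul_rpow ht (ha j), mul_comm t]
  exact dualKernel_lrConst_le hr (mul_nonneg (ha j) ht)

/-- A supporting line of the fine grid at `l`. -/
theorem exists_tangent_lrFineBound {r q : ℝ} (hr : r.HolderConjugate q) {n : ℕ} {a : Fin n → ℝ}
    (ha : ∀ i, 0 < a i) (hanti : Antitone a) {l : ℕ} (hl1 : 1 ≤ l) (hl : l ≤ n) :
    ∃ t, 0 < t ∧
      (∀ j : ℕ, j ≤ n → t * lrFineBound r a j - (j : ℝ) / (n : ℝ) ^ 2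
        ≤ t * lrFineBound r a l - (l : ℝ) / (n : ℝ) ^ 2) ∧
      0 ≤ t * lrFineBound r a l - (l : ℝ) / (n : ℝ) ^ 2 ∧
      avgKernel q a (lrConst r * t) - 1 / r / n
        ≤ t * lrFineBound r a l - (l : ℝ) / (n : ℝ) ^ 2 := by
  have hn : 0 < n := by omega
  have hr0 := hr.pos
  have hq0 := hr.symm.pos
  have hr1 := hr.sub_one_pos
  have hC := lrConst_pos hr
  have ha0 : ∀ i, 0 ≤ a i := fun i => (ha i).le
  have hn0 : (0 : ℝ) < n := by exact_mod_cast hn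
  have hl0 : (0 : ℝ) < l := by exact_mod_cast hl1
  set S : ℕ → ℝ := fun j => ∑ i : Fin n with i.val < j, a i ^ r with hS
  have hS0 : ∀ j, 0 ≤ S j := fun j => Finset.sum_nonneg fun i _ => Real.rpow_nonneg (ha0 i) r
  have hSl : 0 < S l :=
    Finset.sum_pos (fun i _ => Real.rpow_pos_of_pos (ha i) r) ⟨⟨0, hn⟩, by simp; omega⟩
  have hSn : S n = ∑ i, a i ^ r := by simp [hS]
  set β := a ⟨l - 1, by omega⟩ ^ r with hβ
  have hβ0 : 0 ≤ β := Real.rpow_nonneg (ha0 _) r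
  have hbr : Antitone fun i => a i ^ r := fun i j hij =>
    Real.rpow_le_rpow (ha0 j) (hanti hij) hr0.le
  have hSj : ∀ j, j ≤ n → S j ≤ S l + ((j : ℝ) - l) * β := fun j hj =>
    sum_filter_lt_le_add hbr hj hl1 hl
  have hfine : ∀ j, lrFineBound r a j
      = lrConst r * (((j : ℝ) / n / n) ^ (1 / q) * (1 / n * S j) ^ (1 / r)) := fun j => by
    rw [lrFineBound_eq hr ha0, rpow_mul_rpow_div hr hn0 (by positivity) (hS0 j)]
  obtain ⟨τ, hτ, hτ1, hτ2⟩ := exists_mul_lrConst_mul_eq hr (u := (l : ℝ) / n / n)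
    (A := 1 / n * S l) (by positivity) (by positivity)
  rw [← hfine] at hτ2
  -- Linearizing S_j at l multiplies the slope of τ F_j in j/n² by m; dividing τ by m restores slope
  -- 1.
  set m := 1 + τ ^ r * (n * β) with hm
  have hτr : 0 ≤ τ ^ r := by positivity
  have hm1 : 1 ≤ m := by
    have : 0 ≤ τ ^ r * (n * β) := by positivity
    linarith
  have hm0 : 0 < m := by linarith
  have hα : ∀ j : ℕ, j ≤ n → τ / m * lrFineBound r a j - (j : ℝ) / (n : ℝ) ^ 2
        ≤ τ / m * lrFineBound r a l - (l : ℝ) / (n : ℝ) ^ 2 := by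
    intro j hj
    have h1 := mul_lrConst_mul_le hr hτ.le (u := (j : ℝ) / n / n) (A := 1 / n * S j)
      (by positivity) (mul_nonneg (by positivity) (hS0 j))
    rw [← hfine] at h1
    have h2 : τ ^ r * (1 / n * S j) ≤ τ ^ r * (1 / n * (S l + ((j : ℝ) - l) * β)) :=
      mul_le_mul_of_nonneg_left (mul_le_mul_of_nonneg_left (hSj j hj) (by positivity)) hτr
    have h3 : τ ^ r * (1 / n * (S l + ((j : ℝ) - l) * β)) + (j : ℝ) / n / n
        = τ ^ r * (1 / n * S l) + (l : ℝ) / n / n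
          + ((j : ℝ) / n ^ 2 - (l : ℝ) / n ^ 2) * m := by
      rw [hm]
      field_simp
      ring
    have h4 : τ * lrFineBound r a j - τ * lrFineBound r a l
        ≤ ((j : ℝ) / n ^ 2 - (l : ℝ) / n ^ 2) * m := by linarith
    rw [← mul_sub, ← div_le_iff₀ hm0, mul_div_right_comm] at h4
    linarith
  -- The comparison at j = 0, where the fine bound vanishes.
  have hβ' : 0 ≤ τ / m * lrFineBound r a l - (l : ℝ) / (n : ℝ) ^ 2 := by
    have := hα 0 (Nat.zero_le n)
    rw [hfine 0] at this
    simpa [Real.zero_rpow (inv_ne_zero hq0.ne')] using this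
  refine ⟨τ / m, by positivity, hα, hβ', ?_⟩
  set t := τ / m with ht
  have ht0 : 0 < t := by positivity
  have htτ : t ≤ τ := div_le_self hτ.le hm1
  set w := t * S n ^ (1 / r) with hw
  have hw0 : 0 ≤ w := mul_nonneg ht0.le (Real.rpow_nonneg (hS0 n) _)
  have hwr : w ^ r = t ^ r * S n := by
    rw [hw, Real.mul_rpow ht0.le (Real.rpow_nonneg (hS0 n) _), ← Real.rpow_mul (hS0 n),
      one_div_mul_cancel hr0.ne', Real.rpow_one]
  have hlS : l * S n ≤ n * S l := by
    have h1 := hSj n le_rfl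
    have h2 := hSj 0 (Nat.zero_le n)
    have h3 : S 0 = 0 := by simp [hS]
    have h4 : (l : ℝ) ≤ n := by exact_mod_cast hl
    rw [h3, Nat.cast_zero] at h2
    nlinarith
  -- At τ, the equality case gives (r - 1) τ^r n S_l = l; averages of a decreasing sequence
  -- decrease, so l S_n ≤ n S_l, and t ≤ τ.
  have hw1 : (r - 1) * w ^ r ≤ 1 := by
    rw [hwr]
    have h1 : t ^ r ≤ τ ^ r := Real.rpow_le_rpow ht0.le htτ hr0.le
    have h2 : (r - 1) * τ ^ r * (n * S l) = l := by
      field_simp at hτ1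
      linarith
    have h3 : (r - 1) * τ ^ r * (l * S n) ≤ l * 1 := by
      rw [mul_one]
      exact (mul_le_mul_of_nonneg_left hlS (by positivity)).trans h2.le
    have h4 : (r - 1) * τ ^ r * S n ≤ 1 := by
      refine le_of_mul_le_mul_left ?_ hl0
      linarith
    have h5 : (r - 1) * (t ^ r * S n) ≤ (r - 1) * (τ ^ r * S n) :=
      mul_le_mul_of_nonneg_left (mul_le_mul_of_nonneg_right h1 (hS0 n)) hr1.le
    linarith
  have hw2 := mul_rpow_le_lrConst_mul hr hw0 hw1
  have h1 := avgKernel_le_rpow hr ha0 ht0.le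
  have h2 := hα n le_rfl
  rw [lrFineBound_self hr ha0 hn, ← hSn] at h2
  rw [← hSn] at h1
  have h3 : t ^ r * ((1 / (n : ℝ)) * S n) ≤ lrConst r * w / r / n := by
    rw [← mul_assoc, mul_right_comm, ← hwr, mul_one_div]
    refine div_le_div_of_nonneg_right ?_ hn0.le
    rw [le_div_iff₀ hr0]
    linarith
  have h4 : t * (lrConst r * (1 / (n : ℝ) * S n ^ (1 / r))) - n / (n : ℝ) ^ 2
      = (lrConst r * w - 1) / n := by
    rw [hw]
    field_simp
  rw [h4] at h2
  have h5 : lrConst r * w / r / n - 1 / r / n = (lrConst r * w - 1) / n / r := by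
    field_simp
  -- The kernel term is at most 1/r times the line of index n. If that line is nonnegative at t, the
  -- factor 1/r only lowers it; otherwise the term is at most 0.
  rcases le_total 0 ((lrConst r * w - 1) / n) with h6 | h6
  · have h7 := div_le_self h6 hr.lt.le
    linarith
  · have h7 := div_nonpos_of_nonpos_of_nonneg h6 hr0.le
    linarith

/-! ### The Orlicz function of part (i). -/

/-- The largest of the functions `t ↦ t * lrFineBound r a l - l / n ^ 2`, `1 ≤ l ≤ n`. -/
def lrFineConj (r : ℝ) {n : ℕ} (a : Fin n → ℝ) (t : ℝ) : ℝ :=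
  ⨆ l : Fin n, (t * lrFineBound r a (l + 1) - ((l + 1 : ℕ) : ℝ) / (n : ℝ) ^ 2)

/-- A convex function whose dual has an inverse comparable to `lrBound` on the grid `l / n` and to
`lrFineBound` on the grid `l / n ^ 2`. -/
def lrConvex (r q : ℝ) {n : ℕ} (a : Fin n → ℝ) (t : ℝ) : ℝ :=
  max 0 (max (avgKernel q a (lrConst r * t) - 1 / r / n) (lrFineConj r a t))

theorem le_lrFineConj (r : ℝ) {n : ℕ} (a : Fin n → ℝ) (t : ℝ) {l : ℕ} (hl1 : 1 ≤ l)
    (hl : l ≤ n) : t * lrFineBound r a l - (l : ℝ) / (n : ℝ) ^ 2 ≤ lrFineConj r a t := by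
  have h := le_ciSup (f := fun l : Fin n =>
    t * lrFineBound r a (l + 1) - ((l + 1 : ℕ) : ℝ) / (n : ℝ) ^ 2)
    (Set.finite_range _).bddAbove ⟨l - 1, by omega⟩
  simp only [Nat.sub_add_cancel hl1] at h
  exact h

theorem lrFineConj_le {r : ℝ} {n : ℕ} {a : Fin n → ℝ} {t M : ℝ} (hn : 0 < n)
    (h : ∀ l : ℕ, 1 ≤ l → l ≤ n → t * lrFineBound r a l - (l : ℝ) / (n : ℝ) ^ 2 ≤ M) :
    lrFineConj r a t ≤ M := by
  have : Nonempty (Fin n) := ⟨⟨0, hn⟩⟩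
  exact ciSup_le fun l => h (l + 1) (by omega) (by omega)

theorem convexOn_lrFineConj (r : ℝ) {n : ℕ} (a : Fin n → ℝ) (hn : 0 < n) :
    ConvexOn ℝ Set.univ (lrFineConj r a) := by
  refine ⟨convex_univ, fun x _ y _ α β hα hβ hαβ => lrFineConj_le hn fun l hl1 hl => ?_⟩
  have hx := mul_le_mul_of_nonneg_left (le_lrFineConj r a x hl1 hl) hα
  have hy := mul_le_mul_of_nonneg_left (le_lrFineConj r a y hl1 hl) hβ
  obtain rfl : β = 1 - α := by linarith
  simp only [smul_eq_mul] at hx hy ⊢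
  linarith

theorem convexOn_avgKernel {q : ℝ} (hq : 0 < q) {n : ℕ} (a : Fin n → ℝ) :
    ConvexOn ℝ Set.univ (avgKernel q a) := by
  refine ⟨convex_univ, fun x _ y _ α β hα hβ hαβ => ?_⟩
  unfold avgKernel
  simp only [smul_eq_mul]
  rw [mul_left_comm α, mul_left_comm β, ← mul_add, Finset.mul_sum (a := α),
    Finset.mul_sum (a := β), ← Finset.sum_add_distrib]
  refine mul_le_mul_of_nonneg_left (Finset.sum_le_sum fun j _ => ?_) (by positivity)
  have h := (convexOn_dualKernel hq).2 (Set.mem_univ (a j * x)) (Set.mem_univ (a j * y)) hα hβ hαβ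
  simp only [smul_eq_mul] at h
  refine le_trans (le_of_eq ?_) h
  congr 1
  ring

theorem ConvexOn.comp_mul_left {f : ℝ → ℝ} (hf : ConvexOn ℝ Set.univ f) (c : ℝ) :
    ConvexOn ℝ Set.univ fun t => f (c * t) := by
  refine ⟨convex_univ, fun x _ y _ α β hα hβ hαβ => ?_⟩
  have h := hf.2 (Set.mem_univ (c * x)) (Set.mem_univ (c * y)) hα hβ hαβ
  simp only [smul_eq_mul] at h ⊢
  refine le_trans (le_of_eq ?_) h
  congr 1
  ring

theorem convexOn_lrConvex {r q : ℝ} (hq : 0 < q) {n : ℕ} (a : Fin n → ℝ) (hn : 0 < n) :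
    ConvexOn ℝ Set.univ (lrConvex r q a) := by
  refine (convexOn_const 0 convex_univ).sup (ConvexOn.sup ?_ (convexOn_lrFineConj r a hn))
  exact ((convexOn_avgKernel hq a).comp_mul_left (lrConst r)).add_const (-(1 / r / n))

theorem lrConvex_le {r q : ℝ} (hr : r.HolderConjugate q) {n : ℕ} {a : Fin n → ℝ}
    (ha : ∀ i, 0 ≤ a i) (hn : 0 < n) (t : ℝ) :
    lrConvex r q a t ≤ avgKernel q a (lrConst r * t) := by
  have hr0 := hr.pos
  refine max_le (avgKernel_nonneg hr.symm.pos _ _) (max_le ?_ (lrFineConj_le hn fun l _ hl =>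
    mul_lrFineBound_sub_le hr ha hn hl t))
  have : 0 ≤ 1 / r / n := by positivity
  linarith

theorem avgKernel_sub_le_lrConvex (r q : ℝ) {n : ℕ} (a : Fin n → ℝ) (t : ℝ) :
    avgKernel q a (lrConst r * t) - 1 / r / n ≤ lrConvex r q a t :=
  (le_max_left _ _).trans (le_max_right _ _)

theorem lrFineConj_le_lrConvex (r q : ℝ) {n : ℕ} (a : Fin n → ℝ) (t : ℝ) :
    lrFineConj r a t ≤ lrConvex r q a t :=
  (le_max_right _ _).trans (le_max_right _ _)

theorem avgKernel_zero {q : ℝ} (hq : 0 < q) {n : ℕ} (a : Fin n → ℝ) : avgKernel q a 0 = 0 := by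
  simp [avgKernel, dualKernel_zero hq]

/-- Near-optimal points for the coarse upper bound. -/
theorem exists_avgKernel_add_le {r q : ℝ} (hr : r.HolderConjugate q) {n : ℕ} {a : Fin n → ℝ}
    (ha : ∀ i, 0 ≤ a i) {l : ℕ} (hl1 : 1 ≤ l) (hl : l ≤ n) {ε : ℝ} (hε : 0 < ε) :
    ∃ t, 0 < t ∧ avgKernel q a (lrConst r * t) + (l : ℝ) / n ≤ t * (lrBound r a l + ε) := by
  have hn : 0 < n := by omega
  have hr0 := hr.pos
  have hq0 := hr.symm.pos
  have hC := lrConst_pos hr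
  have hn0 : (0 : ℝ) < n := by exact_mod_cast hn
  have hl0 : (0 : ℝ) < l := by exact_mod_cast hl1
  set A := ∑ i : Fin n with i.val < l, a i with hA
  set R := ∑ i : Fin n with l ≤ i.val, a i ^ r with hR
  have hR0 : 0 ≤ R := Finset.sum_nonneg fun j _ => Real.rpow_nonneg (ha j) r
  have hB : lrBound r a l = lrConst r * ((1 / (n : ℝ)) * A)
      + lrConst r * (((l : ℝ) / n) ^ (1 / q) * (1 / n * R) ^ (1 / r)) := by
    unfold lrBound
    rw [hr.conjExponent_eq, mul_add]
    simp only [abs_of_nonneg (ha _)]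
    rfl
  have hup : ∀ t, 0 < t → avgKernel q a (lrConst r * t)
      ≤ t * (lrConst r * ((1 / (n : ℝ)) * A)) + t ^ r * (1 / n * R) := by
    intro t ht
    have h1 : ∑ i : Fin n with i.val < l, dualKernel q (a i * (lrConst r * t))
        ≤ lrConst r * t * A := by
      rw [hA, Finset.mul_sum]
      refine Finset.sum_le_sum fun i _ => ?_
      rw [mul_comm (a i)]
      exact dualKernel_le_self hq0 (mul_nonneg (by positivity) (ha i))
    have h2 : ∑ i : Fin n with l ≤ i.val, dualKernel q (a i * (lrConst r * t)) ≤ t ^ r * R := by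
      rw [hR, Finset.mul_sum]
      refine Finset.sum_le_sum fun i _ => ?_
      rw [mul_left_comm, ← Real.mul_rpow ht.le (ha i), mul_comm t]
      exact dualKernel_lrConst_le hr (mul_nonneg (ha i) ht.le)
    unfold avgKernel
    rw [← sum_filter_lt_add_sum_filter_le _ l]
    have h3 := mul_le_mul_of_nonneg_left (add_le_add h1 h2)
      (by positivity : (0 : ℝ) ≤ 1 / n)
    linarith
  rw [hB]
  -- With an empty or vanishing tail the infimum over t is only approached as t grows, whence the
  -- slack ε.
  rcases hR0.eq_or_lt with hz | hpos
  · refine ⟨(l : ℝ) / n / ε, by positivity, ?_⟩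
    have h := hup ((l : ℝ) / n / ε) (by positivity)
    have e : (l : ℝ) / n / ε * ε = (l : ℝ) / n := div_mul_cancel₀ _ hε.ne'
    rw [← hz, mul_zero, mul_zero, add_zero] at h
    rw [← hz, mul_zero, Real.zero_rpow (by positivity), mul_zero, mul_zero, add_zero, mul_add, e]
    linarith
  · obtain ⟨τ, hτ, -, hτ2⟩ := exists_mul_lrConst_mul_eq hr (u := (l : ℝ) / n) (A := 1 / n * R)
      (by positivity) (by positivity)
    refine ⟨τ, hτ, ?_⟩
    have h := hup τ hτ
    have : 0 < τ * ε := by positivity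
    rw [mul_add, mul_add, hτ2]
    linarith

/-- Passing from M to N(t) = M(σt) + δt changes an upper bound B for the inverse dual into σB + δ
and a lower bound s into σs. As σ ≥ 1/2, lower bounds lose at most a factor 2. -/
theorem exists_isOrlicz {r q : ℝ} (hr : r.HolderConjugate q) {n : ℕ} {a : Fin n → ℝ}
    (hanti : Antitone a) (ha' : ∀ i, 0 < a i) (hn : 0 < n) :
    ∃ N : ℝ → ℝ, IsOrlicz N ∧
      (∀ l : ℕ, 1 ≤ l → l ≤ n →
        orliczDualInv N ((l : ℝ) / n) ≤ lrBound r a l ∧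
        lrBound r a l ≤ 8 * orliczDualInv N ((l : ℝ) / n)) ∧
      (∀ l : ℕ, 1 ≤ l → l ≤ n →
        orliczDualInv N ((l : ℝ) / (n : ℝ) ^ 2) ≤ lrFineBound r a l ∧
        lrFineBound r a l ≤ 2 * orliczDualInv N ((l : ℝ) / (n : ℝ) ^ 2)) ∧
      (∀ x : Fin n → ℝ,
        1 / 8 * orliczNorm N x ≤ permAverage r a x ∧
        permAverage r a x ≤ 2 * orliczNorm N x) := by
  have ha : ∀ i, 0 ≤ a i := fun i => (ha' i).le
  have hr0 := hr.pos
  have hq0 := hr.symm.pos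
  have hC := lrConst_pos hr
  have hC2 := lrConst_le_two hr
  have hn0 : (0 : ℝ) < n := by exact_mod_cast hn
  obtain ⟨σ, hσ, hσ1, hσP⟩ := exists_lt_one_permAverage_le hr
  have hσ0 : 0 < σ := by linarith
  -- Half of the room left by σ at the smallest fine bound F_1, which all other bounds dominate; the
  -- other half absorbs the slack in the coarse upper bound.
  set δ := (1 - σ) * lrFineBound r a 1 / 2 with hδ
  have hf1 := lrFineBound_pos hr ha' hn le_rfl
  have hδ0 : 0 < δ := div_pos (mul_pos (by linarith) hf1) two_pos
  set M := lrConvex r q a with hM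
  have hM0 : ∀ t, 0 ≤ M t := fun t => le_max_left _ _
  set N : ℝ → ℝ := fun t => M (σ * t) + δ * t with hNdef
  have hN : IsOrlicz N := by
    refine ⟨?_, ?_, fun t ht => ?_⟩
    · refine ConvexOn.subset (ConvexOn.add ((convexOn_lrConvex hq0 a hn).comp_mul_left σ) ?_)
        (Set.subset_univ _) (convex_Ici 0)
      exact ((convexOn_id convex_univ).smul hδ0.le)
    · have h := lrConvex_le hr ha hn 0
      rw [mul_zero, avgKernel_zero hq0] at h
      simp only [hNdef, mul_zero, add_zero]
      exact le_antisymm h (hM0 0)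
    · have := hM0 (σ * t)
      have := mul_pos hδ0 ht
      simp only [hNdef]
      linarith
  have hNd := hN.isDegenerateOrlicz
  -- upper and lower bounds for the inverse of the dual of `N` from bounds for `M`
  have hupper : ∀ u t B : ℝ, 0 ≤ u → 0 < t → M t + u ≤ t * B →
      orliczDualInv N u ≤ σ * B + δ := by
    intro u t B hu ht h
    have h1 := orliczDualInv_mul_le hNd hu (t := t / σ) (by positivity)
    simp only [hNdef] at h1
    rw [mul_div_cancel₀ _ hσ0.ne'] at h1
    refine le_of_mul_le_mul_right (h1.trans ?_) (by positivity : 0 < t / σ)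
    have e : σ * B * (t / σ) = t * B := by field_simp
    rw [add_mul, e]
    linarith
  have hlower : ∀ u s : ℝ, 0 ≤ u → 0 ≤ s → (∀ t, 0 ≤ t → s * t - M t ≤ u) →
      σ * s ≤ orliczDualInv N u := by
    intro u s hu hs h
    refine le_orliczDualInv hNd hu (by positivity) fun t ht => ?_
    have h1 := h (σ * t) (by positivity)
    have h2 := mul_nonneg hδ0.le ht
    simp only [hNdef]
    linarith
  have hfine_low : ∀ l : ℕ, 1 ≤ l → l ≤ n →
      lrFineBound r a l ≤ 2 * orliczDualInv N ((l : ℝ) / (n : ℝ) ^ 2) := by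
    intro l hl1 hl
    have hfl := lrFineBound_pos hr ha' hn hl1
    have h := hlower ((l : ℝ) / (n : ℝ) ^ 2) (lrFineBound r a l) (by positivity)
      hfl.le (fun t ht => by
        have h1 := (le_lrFineConj r a t hl1 hl).trans (lrFineConj_le_lrConvex r q a t)
        rw [← hM] at h1
        linarith)
    nlinarith
  refine ⟨N, hN, fun l hl1 hl => ⟨?_, ?_⟩, fun l hl1 hl => ⟨?_, hfine_low l hl1 hl⟩, ?_⟩
  · obtain ⟨t, ht, h⟩ := exists_avgKernel_add_le hr ha hl1 hl hδ0
    have h1 := hupper ((l : ℝ) / n) t (lrBound r a l + δ) (by positivity) ht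
      (by linarith [lrConvex_le hr ha hn t])
    have h2 := mul_le_mul_of_nonneg_left (lrFineBound_one_le_lrBound hr ha hn hl1)
      (by linarith : 0 ≤ 1 - σ)
    have h3 : σ * δ ≤ δ := mul_le_of_le_one_left hδ0.le hσ1.le
    linarith
  · rcases hl1.eq_or_lt with rfl | hl2
    -- The loss 1/(rn) in M is too large at ℓ = 1; there the fine bound at n is used, since n/n² =
    -- 1/n.
    · have h1 := hfine_low n hn le_rfl
      have h2 := lrBound_one_le hr ha hn
      rw [← lrFineBound_self hr ha hn] at h2
      have h3 : (n : ℝ) / (n : ℝ) ^ 2 = (1 : ℕ) / (n : ℝ) := by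
        rw [Nat.cast_one]
        field_simp
      rw [h3] at h1
      have h4 := lrFineBound_pos hr ha' hn hn
      linarith
    · obtain ⟨w, w0, w1, hw, hwl⟩ := exists_lrBound_le hr ha hanti hn hl
      have hs0 : 0 ≤ (1 / (n : ℝ)) * ∑ j, a j * w j :=
        mul_nonneg (by positivity) (Finset.sum_nonneg fun j _ => mul_nonneg (ha j) (w0 j))
      have h := hlower ((l : ℝ) / n) (lrConst r * ((1 / (n : ℝ)) * ∑ j, a j * w j) / 2)
        (by positivity) (by positivity) (fun t ht => by
          -- Halving the weights at least halves their mass, and for ℓ ≥ 2 the freed ℓ/(2n) covers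
          -- 1/(rn).
          have h1 := le_avgKernel hq0 a (lrConst r * t) (s := fun j => 1 / 2 * w j)
            (fun j => mul_nonneg (by norm_num) (w0 j)) (fun j => by linarith [w1 j])
          have h2 := avgKernel_sub_le_lrConvex r q a t
          have h3 : ∑ j, (1 / 2 * w j) ^ q ≤ l / 2 := by
            calc _ ≤ ∑ j, 1 / 2 * w j ^ q := Finset.sum_le_sum fun j _ => by
                  rw [Real.mul_rpow (by norm_num) (w0 j)]
                  refine mul_le_mul_of_nonneg_right ?_ (Real.rpow_nonneg (w0 j) q)
                  calc (1 / 2 : ℝ) ^ q ≤ (1 / 2 : ℝ) ^ (1 : ℝ) :=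
                        Real.rpow_le_rpow_of_exponent_ge (by norm_num) (by norm_num)
                          hr.symm.lt.le
                    _ = 1 / 2 := Real.rpow_one _
              _ ≤ _ := by
                rw [← Finset.mul_sum]
                linarith
          have h4 : ∑ j, a j * (1 / 2 * w j) = 1 / 2 * ∑ j, a j * w j := by
            rw [Finset.mul_sum]
            exact Finset.sum_congr rfl fun j _ => by ring
          have h5 : (1 / (n : ℝ)) * ∑ j, (1 / 2 * w j) ^ q ≤ (l : ℝ) / n / 2 := by
            have := mul_le_mul_of_nonneg_left h3 (by positivity : (0 : ℝ) ≤ 1 / n)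
            refine this.trans (le_of_eq ?_)
            ring
          have h6 : 1 / r / n ≤ (l : ℝ) / n / 2 := by
            rw [div_right_comm (l : ℝ)]
            refine div_le_div_of_nonneg_right ?_ hn0.le
            have : (2 : ℝ) ≤ l := by exact_mod_cast hl2
            have : 1 / r ≤ 1 := (div_le_one hr0).2 hr.lt.le
            linarith
          rw [h4] at h1
          rw [← hM] at h2
          linarith)
      have h7 : 0 ≤ orliczDualInv N ((l : ℝ) / n) := orliczDualInv_nonneg hNd (by positivity)
      have h8 : 0 ≤ lrConst r * ((1 / (n : ℝ)) * ∑ j, a j * w j) := by positivity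
      nlinarith
  · obtain ⟨t, ht, h1, h2, h3⟩ := exists_tangent_lrFineBound hr ha' hanti hl1 hl
    have h4 : M t ≤ t * lrFineBound r a l - (l : ℝ) / (n : ℝ) ^ 2 :=
      max_le h2 (max_le h3 (lrFineConj_le hn fun j _ hj => h1 j hj))
    have h5 := hupper ((l : ℝ) / (n : ℝ) ^ 2) t (lrFineBound r a l) (by positivity) ht
      (by linarith)
    have h6 := mul_le_mul_of_nonneg_left (lrFineBound_mono hr ha hl1)
      (by linarith : 0 ≤ 1 - σ)
    linarith
  · have hlow : ∀ x : Fin n → ℝ, (∀ i, 0 ≤ x i) → permAverage r a x < 1 / 8 →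
        ∑ i, N (x i) ≤ 1 := by
      intro x hx hxa
      have hP := permAverage_nonneg r a x
      have hδn : δ ≤ lrFineBound r a n := by
        have h1 := lrFineBound_mono hr ha (l := 1) hn
        have h2 : (1 - σ) * lrFineBound r a 1 ≤ lrFineBound r a 1 :=
          mul_le_of_le_one_left hf1.le (by linarith)
        linarith
      have h1 : ∑ i, N (x i) ≤ ∑ i, (avgKernel q a (2 * lrConst r * σ * x i) / 2
          + x i * lrFineBound r a n) := by
        refine Finset.sum_le_sum fun i _ => ?_
        have h2 := lrConvex_le hr ha hn (σ * x i)
        have h3 := avgKernel_le_half hq0 a (lrConst r * (σ * x i))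
        have h4 := mul_le_mul_of_nonneg_left hδn (hx i)
        rw [show 2 * (lrConst r * (σ * x i)) = 2 * lrConst r * σ * x i by ring] at h3
        simp only [hNdef, hM]
        linarith
      rw [Finset.sum_add_distrib (f := fun i => avgKernel q a _ / 2), ← Finset.sum_div] at h1
      have h2 := sum_mul_rpow_sum_le hr ha hx
      rw [← lrFineBound_self hr ha hn] at h2
      have h3 := sum_avgKernel_le_one hr (x := fun i => 2 * lrConst r * σ * x i) ha
        (fun i => mul_nonneg (by positivity) (hx i)) (by
          rw [permAverage_mul_of_nonneg hr0 hx (by positivity)]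
          have : 2 * lrConst r * σ ≤ 4 := by nlinarith
          nlinarith)
      linarith
    intro x
    have key := orliczNorm_le_permAverage hr0 (by norm_num) hlow x
    refine ⟨key.2, permAverage_le_orliczNorm hr0 (by norm_num) (fun x hx hxN => ?_) x
      (key.1 (permAverage r a x / (1 / 8) + 1) (by linarith))⟩
    -- The n losses 1/(rn) add up to 1/r, so the kernels sum to at most 1 + 1/r; the resulting bound
    -- 2σ for σx gives exactly 2 for x.
    have h1 := hσP n a (fun i => σ * x i) ha (fun i => mul_nonneg hσ0.le (hx i)) (by
      have h2 : ∑ i, avgKernel q a (lrConst r * (σ * x i)) ≤ ∑ i, (N (x i) + 1 / r / n) :=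
        Finset.sum_le_sum fun i _ => by
          have h3 := avgKernel_sub_le_lrConvex r q a (σ * x i)
          have h4 := mul_nonneg hδ0.le (hx i)
          simp only [hNdef, hM]
          linarith
      rw [Finset.sum_add_distrib, Finset.sum_const, Finset.card_univ, Fintype.card_fin,
        nsmul_eq_mul, mul_div_cancel₀ _ hn0.ne'] at h2
      linarith)
    rw [permAverage_mul_of_nonneg hr0 hx hσ0.le, mul_comm] at h1
    exact le_of_mul_le_mul_right h1 hσ0

end

theorem mainTheorem4 :
    -- part (i)
    (∃ c : ℝ, 0 < c ∧ ∀ (r : ℝ), 1 < r → ∀ (n : ℕ) (a : Fin n → ℝ),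
      Antitone a → (∀ i, 0 < a i) →
      ∃ N : ℝ → ℝ, IsOrlicz N ∧
        (∀ l : ℕ, 1 ≤ l → l ≤ n →
          orliczDualInv N ((l : ℝ) / n) ≤ lrBound r a l ∧
          lrBound r a l ≤ 8 * orliczDualInv N ((l : ℝ) / n)) ∧
        (∀ l : ℕ, 1 ≤ l → l ≤ n →
          orliczDualInv N ((l : ℝ) / (n : ℝ) ^ 2) ≤ lrFineBound r a l ∧
          lrFineBound r a l ≤ 2 * orliczDualInv N ((l : ℝ) / (n : ℝ) ^ 2)) ∧
        (∀ x : Fin n → ℝ,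
          c * orliczNorm N x ≤ permAverage r a x ∧
          permAverage r a x ≤ 2 * orliczNorm N x)) ∧
    -- part (ii)
    (∀ (r : ℝ), 1 < r → ∃ (n₀ : ℕ) (α β : ℝ), 0 < α ∧ 0 < β ∧
      ∀ (n : ℕ), n₀ ≤ n → ∀ (a : Fin n → ℝ), Antitone a → (∀ i, 0 < a i) →
      ∀ N : ℝ → ℝ, IsDegenerateOrlicz N →
        (∀ l : ℕ, 1 ≤ l → l ≤ n →
          orliczDualInv N ((l : ℝ) / n) ≤ lrBound r a l ∧
          lrBound r a l ≤ 8 * orliczDualInv N ((l : ℝ) / n)) →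
        AffineOnGrid n (orliczDualInv N) →
        ∀ x : Fin n → ℝ,
          α * orliczNorm N x ≤ permAverage r a x ∧
          permAverage r a x ≤ β * orliczNorm N x) := by
  -- In (ii) absolute constants suffice, with no lower restriction on n.
  refine ⟨⟨1 / 8, by norm_num, fun r hr n a hanti ha => ?_⟩, fun r hr =>
    ⟨0, 1 / 16, 24, by norm_num, by norm_num, fun n _ a hanti ha N hN h _ x =>
      permAverage_equiv_of_grid_bounds (Real.HolderConjugate.conjExponent hr)
        (fun i => (ha i).le) hanti hN h x⟩⟩
  have hr' := Real.HolderConjugate.conjExponent hr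
  rcases Nat.eq_zero_or_pos n with rfl | hn
  -- For n = 0 both grids are empty and the mean is 0, so any Orlicz function serves.
  · refine ⟨id, ⟨convexOn_id (convex_Ici 0), rfl, fun t ht => ht⟩, fun l h1 h2 => by omega,
      fun l h1 h2 => by omega, fun x => ?_⟩
    have key := orliczNorm_le_permAverage hr'.pos (by norm_num : (0 : ℝ) < 1 / 8) (a := a)
      (N := id) (fun x _ _ => by simp) x
    refine ⟨key.2, permAverage_le_orliczNorm hr'.pos two_pos (fun x _ _ => ?_) x
      (key.1 (permAverage r a x / (1 / 8) + 1) (by linarith))⟩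
    have hr0 : r⁻¹ ≠ 0 := hr'.inv_ne_zero
    simp [permAverage, Real.zero_rpow hr0]
  · exact exists_isOrlicz hr' hanti ha hn
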